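/- Let $\lambda$ be Lebesgue measure and let $\{t\}$ denote the fractional part of $t$. Let $a>0$ and $\delta\ge 0$ satisfy $2a+\delta<1$. Let $(u_n)_{n\ge 1}$ be a sequence of positive real numbers that is $\delta$-sublacunary, that is, there is $c\in(0,1)$ such that $u_{n+1}/u_n\ge 1+cn^{-\delta}$ for every $n\ge 1$. Let $(I_n)_{n\ge 1}$ be subsets of $[0,1]$ with $\lambda(I_n)=n^{-a}$ such that, for some $\ell\in\mathbb N$, each $I_n$ is a union of at most $\ell$ intervals. Then for $\lambda$-almost every $y\in[0,1]$ the set $$\Lambda_y=\{n\ge 1:\ \{u_ny\}\in I_n\}=\{a_1(y)<a_2(y)<\cdots\}$$ is infinite, and its increasing enumeration $(a_n(y))_{n\ge1}$ is pointwise universally $L^2$-good and ergodic. That is, for almost every $y\in[0,1]$ the following holds for every probability space $(X,\mathcal X,\mu)$, every measurable $T:X\to X$ with $\mu(T^{-1}A)=\mu(A)$ for all $A\in\mathcal X$, and every real- or complex-valued $f\in L^2(\mu)$: the averages $\frac1N\sum_{n=1}^N f(T^{a_n(y)}x)$ converge as $N\to\infty$ for $\mu$-almost every $x\in X$ (pointwise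 universally $L^2$-good), and they converge in $L^2(\mu)$ to $\mathbb E(f\mid\mathcal I(T))$, where $\mathcal I(T)=\{A\in\mathcal X:\ \mu(A\,\triangle\,T^{-1}A)=0\}$ (ergodic). In other words, $$\lim_{N\to\infty}\frac1N\sum_{n=1}^N f\big(T^{a_n(y)}x\big)=\mathbb E(f\mid\mathcal I(T))(x)\qquad\text{for }\mu\text{-a.e. }x\in X.$$ -/

import Mathlib

open MeasureTheory Set Filter Topology
open scoped ENNReal

universe v w

/-- A sequence `(u n)_{n ≥ 1}` of positive reals is `δ`-sublacunary if for some `c ∈ (0, 1)`,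
`u (n + 1) / u n ≥ 1 + c * n ^ (-δ)` for every `n ≥ 1`. The value `u 0` is irrelevant. -/
def IsSublacunary (δ : ℝ) (u : ℕ → ℝ) : Prop :=
  (∀ n : ℕ, 1 ≤ n → 0 < u n) ∧
    ∃ c : ℝ, 0 < c ∧ c < 1 ∧
      ∀ n : ℕ, 1 ≤ n → 1 + c * (n : ℝ) ^ (-δ) ≤ u (n + 1) / u n

/-- `I` is a union of at most `ℓ` intervals. The intervals of `ℝ` are the order-connected sets;
the empty set is one of them, so that exactly `ℓ` of them may be used. -/
def IsUnionOfIntervals (ℓ : ℕ) (I : Set ℝ) : Prop :=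
  ∃ J : Fin ℓ → Set ℝ, (∀ i, (J i).OrdConnected) ∧ I = ⋃ i, J i

/-- The set `Λ_y` of the integers `n ≥ 1` such that the fractional part of `u n * y`
lies in `I n`. -/
def hittingSet (u : ℕ → ℝ) (I : ℕ → Set ℝ) (y : ℝ) : Set ℕ :=
  {n : ℕ | 1 ≤ n ∧ Int.fract (u n * y) ∈ I n}

/-- The increasing enumeration of an infinite set of natural numbers, starting at index `0`. -/
noncomputable def increasingEnum (Λ : Set ℕ) : ℕ → ℕ :=
  Nat.nth (fun n => n ∈ Λ)

/-- The `σ`-algebra `{A measurable | μ (A ∆ T⁻¹ A) = 0}` of `μ`-almost invariant sets. -/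
@[reducible]
def almostInvariants {X : Type v} [MeasurableSpace X] (μ : Measure X) (T : X → X) :
    MeasurableSpace X where
  MeasurableSet' A := MeasurableSet A ∧ μ (symmDiff A (T ⁻¹' A)) = 0
  measurableSet_empty := by simp
  measurableSet_compl A hA := by
    refine ⟨hA.1.compl, ?_⟩
    have h := hA.2
    rw [measure_symmDiff_eq_zero_iff] at h ⊢
    simpa [preimage_compl] using h.compl
  measurableSet_iUnion A hA := by
    refine ⟨MeasurableSet.iUnion fun i => (hA i).1, ?_⟩
    rw [measure_symmDiff_eq_zero_iff, preimage_iUnion]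
    exact Filter.EventuallyEq.countable_iUnion fun i => measure_symmDiff_eq_zero_iff.1 (hA i).2

theorem almostInvariants_le {X : Type v} [m : MeasurableSpace X] (μ : Measure X) (T : X → X) :
    almostInvariants μ T ≤ m :=
  fun _ hA => hA.1

/-- The average `(1 / N) * (f (T ^ (a 0) x) + ⋯ + f (T ^ (a (N - 1)) x))` of `f` along the
first `N` terms of the sequence `a`. -/
noncomputable def ergodicAverage {X : Type v} {𝕜 : Type w} [RCLike 𝕜] (a : ℕ → ℕ) (T : X → X)
    (f : X → 𝕜) (N : ℕ) (x : X) : 𝕜 :=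
  (N : 𝕜)⁻¹ * ∑ n ∈ Finset.range N, f (T^[a n] x)

/-- The sequence `a` is pointwise universally `L^p`-good (for `𝕜`-valued functions): in every
measure-preserving system on a probability space, the averages along `a` of every `f ∈ L^p`
converge almost everywhere. -/
def IsPointwiseUniversallyGood (𝕜 : Type w) [RCLike 𝕜] (p : ℝ≥0∞) (a : ℕ → ℕ) : Prop :=
  ∀ (X : Type v) [MeasurableSpace X] (μ : Measure X) [IsProbabilityMeasure μ] (T : X → X),
    MeasurePreserving T μ μ → ∀ f : X → 𝕜, MemLp f p μ →
      ∀ᵐ x ∂μ, ∃ L : 𝕜, Tendsto (fun N : ℕ => ergodicAverage a T f N x) atTop (𝓝 L)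

/-- The sequence `a` is ergodic (for `𝕜`-valued functions): in every measure-preserving system
on a probability space, the averages along `a` of every `f ∈ L²` converge in `L²` to the
conditional expectation of `f` on the `σ`-algebra of almost invariant sets. -/
def IsErgodicSequence (𝕜 : Type w) [RCLike 𝕜] (a : ℕ → ℕ) : Prop :=
  ∀ (X : Type v) [MeasurableSpace X] (μ : Measure X) [IsProbabilityMeasure μ] (T : X → X),
    MeasurePreserving T μ μ → ∀ f : X → 𝕜, MemLp f 2 μ →
      Tendsto (fun N : ℕ => eLpNorm (ergodicAverage a T f N - μ[f | almostInvariants μ T]) 2 μ)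
        atTop (𝓝 0)

/-! Let `X n` be the indicator of the event that `n` is hit and let `Y n = X n - n ^ (-a)`. Fix `κ`
with `δ < κ < 1 - 2 * a`. Below `N`, sublacunarity gives `u q / u p ≤ N ^ (-2)` once `p - q ≥ N ^ κ`
(`IsSublacunary.exists_div_le`). Factors with index at most `p - N ^ κ` have variation small
compared with `u p`, while `Y p` has mean zero over each period `1 / u p`. Integrals of such factors
against `Y p` are therefore `O(N ^ (-2))` (`abs_integral_mul_comp_mul_le`,
`isNearlyUncorrelated_hitSequence`).

For `m ≥ N ^ κ` this bounds the second moment of `∑ Y n * Y (n + m)` by `O(N ^ (κ + 1 - 2 * a))`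
(`integral_sq_sum_le`). Summing first moments over all `m < N` gives `O(N ^ ((3 + κ) / 2 - a))`, a
power smaller than `N ^ (2 - 2 * a)`. So for almost every `y` the normalized autocorrelation sums
are summable along `N = k ^ s` with `s` large (`exists_ae_summable`).

From here `y` is fixed and the argument is deterministic, so one null set serves all systems. Van
der Corput's inequality (`integral_sq_sum_iterate_le`) controls the `L²` norm of `∑ Y n * f (T^[n]
x)` by the autocorrelations of `Y` alone. Hence these sums, divided by `weightSum a N`, which is at
least `N ^ (1 - a) / 2` for `N ≥ 2`, tend to zero almost everywhere along `k ^ s`. The remaining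
averages with weights `n ^ (-a)` converge by Birkhoff's theorem and summation by parts. For `f ≥ 0`,
monotonicity fills the gaps between consecutive `k ^ s`. Taking `f = 1` gives the counting
asymptotics, and division turns weighted averages into averages along the enumeration. Linearity
covers general `f`, and uniform integrability with density of simple functions gives `L²`
convergence. -/

/-! ### Maximal inequality and Birkhoff's pointwise ergodic theorem. -/

section Birkhoff

variable {X : Type v} {T : X → X}

/-- The maximum of `0` and the first `n` Birkhoff sums of `g`. -/
noncomputable def maxBirkhoff (T : X → X) (g : X → ℝ) : ℕ → X → ℝ
  | 0 => fun _ => 0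
  | n + 1 => fun x => max 0 (g x + maxBirkhoff T g n (T x))

theorem maxBirkhoff_nonneg (g : X → ℝ) (n : ℕ) (x : X) : 0 ≤ maxBirkhoff T g n x := by
  cases n <;> simp [maxBirkhoff]

theorem maxBirkhoff_le_succ (g : X → ℝ) (n : ℕ) (x : X) :
    maxBirkhoff T g n x ≤ maxBirkhoff T g (n + 1) x := by
  induction n generalizing x with
  | zero => exact maxBirkhoff_nonneg g 1 x
  | succ n ih => exact max_le_max le_rfl (add_le_add le_rfl (ih (T x)))

theorem birkhoffSum_le_maxBirkhoff (g : X → ℝ) (n : ℕ) (x : X) :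
    birkhoffSum T g n x ≤ maxBirkhoff T g n x := by
  induction n generalizing x with
  | zero => simp [maxBirkhoff]
  | succ n ih =>
    rw [birkhoffSum_succ']
    exact le_max_of_le_right (add_le_add le_rfl (ih (T x)))

/-- Makes the set of points with unbounded Birkhoff sums strictly invariant, so that the maximal
theorem applies on it. -/
theorem bddAbove_birkhoffSum_comp_iff (g : X → ℝ) (x : X) :
    BddAbove (range fun n => birkhoffSum T g n (T x)) ↔
      BddAbove (range fun n => birkhoffSum T g n x) := by
  constructor
  · rintro ⟨K, hK⟩
    refine ⟨max 0 (g x + K), ?_⟩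
    rintro _ ⟨n, rfl⟩
    cases n with
    | zero => simp
    | succ n =>
      simp only [birkhoffSum_succ']
      exact le_max_of_le_right (add_le_add le_rfl (hK ⟨n, rfl⟩))
  · rintro ⟨K, hK⟩
    refine ⟨K - g x, ?_⟩
    rintro _ ⟨n, rfl⟩
    have := hK ⟨n + 1, rfl⟩
    simp only [birkhoffSum_succ'] at this
    simp only
    linarith

theorem birkhoffSum_sub_const (h : X → ℝ) (c : ℝ) (n : ℕ) (x : X) :
    birkhoffSum T (fun x => h x - c) n x = birkhoffSum T h n x - n * c := by
  simp [birkhoffSum, Finset.sum_sub_distrib]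

variable [MeasurableSpace X] {μ : Measure X}

theorem integrable_maxBirkhoff (hT : MeasurePreserving T μ μ) {g : X → ℝ} (hg : Integrable g μ)
    (n : ℕ) : Integrable (maxBirkhoff T g n) μ := by
  induction n with
  | zero => exact integrable_zero _ _ _
  | succ n ih =>
    exact (integrable_zero X ℝ μ).sup (hg.add (hT.integrable_comp_of_integrable ih))

theorem measurable_maxBirkhoff (hT : Measurable T) {g : X → ℝ} (hg : Measurable g) (n : ℕ) :
    Measurable (maxBirkhoff T g n) := by
  induction n with
  | zero => exact measurable_const
  | succ n ih => exact measurable_const.max (hg.add (ih.comp hT))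

/-- Garsia's argument: where `M > 0`, one has `M ≤ g + M ∘ T`; elsewhere `M = 0 ≤ M ∘ T`. So `M - M
∘ T` lies below the restriction of `g` to `{M > 0}`, and its integral vanishes by invariance. -/
theorem setIntegral_maxBirkhoff_pos_nonneg (hT : MeasurePreserving T μ μ) {g : X → ℝ}
    (hg : Integrable g μ) (hgm : Measurable g) (n : ℕ) :
    0 ≤ ∫ x in {x | 0 < maxBirkhoff T g n x}, g x ∂μ := by
  set M := maxBirkhoff T g n with hM
  have hMi : Integrable M μ := integrable_maxBirkhoff hT hg n
  have hMT : Integrable (fun x => M (T x)) μ := hT.integrable_comp_of_integrable hMi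
  have hms : MeasurableSet {x | 0 < M x} :=
    measurableSet_lt measurable_const (measurable_maxBirkhoff hT.measurable hgm n)
  have hint : ∫ x, M (T x) ∂μ = ∫ x, M x ∂μ := by
    rw [← integral_map hT.measurable.aemeasurable
      (by rw [hT.map_eq]; exact hMi.aestronglyMeasurable), hT.map_eq]
  have key : ∀ x, M x - M (T x) ≤ ({x | 0 < M x}).indicator g x := by
    intro x
    by_cases hx : 0 < M x
    · rw [indicator_of_mem (by exact hx)]
      have h1 := maxBirkhoff_le_succ (T := T) g n (T x)
      have h2 := maxBirkhoff_le_succ (T := T) g n x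
      have h3 : maxBirkhoff T g (n + 1) x = max 0 (g x + maxBirkhoff T g n (T x)) := rfl
      have h4 : 0 < maxBirkhoff T g (n + 1) x := lt_of_lt_of_le hx h2
      rw [h3] at h4 h2
      rcases max_cases 0 (g x + maxBirkhoff T g n (T x)) with h | h
      · linarith [h.1]
      · rw [h.1] at h2; linarith
    · rw [indicator_of_notMem (by exact hx)]
      have h1 : 0 ≤ M (T x) := maxBirkhoff_nonneg g n (T x)
      have h2 : M x ≤ 0 := not_lt.1 hx
      linarith
  rw [← integral_indicator hms]
  calc (0 : ℝ) = ∫ x, (M x - M (T x)) ∂μ := by rw [integral_sub hMi hMT, hint, sub_self]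
    _ ≤ _ := integral_mono (hMi.sub hMT) (hg.indicator hms) key

/-- A form of the maximal ergodic theorem on an invariant set. -/
theorem setIntegral_nonneg_of_exists_birkhoffSum_pos (hT : MeasurePreserving T μ μ) {g : X → ℝ}
    (hg : Integrable g μ) (hgm : Measurable g) {A : Set X} (hA : MeasurableSet A)
    (hTA : T ⁻¹' A = A) (hpos : ∀ x ∈ A, ∃ n, 0 < birkhoffSum T g n x) :
    0 ≤ ∫ x in A, g x ∂μ := by
  have hmem : ∀ x, T x ∈ A ↔ x ∈ A := fun x => by
    conv_rhs => rw [← hTA]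
    rfl
  -- Cutting `g` off outside the invariant set `A` keeps the Birkhoff sums on `A` and kills the
  -- maxima off `A`, so the sets where the maxima are positive increase exactly to `A`.
  set h := A.indicator g with hh
  have hhi : Integrable h μ := hg.indicator hA
  have hhm : Measurable h := hgm.indicator hA
  have hin : ∀ n, ∀ x ∈ A, birkhoffSum T h n x = birkhoffSum T g n x := by
    intro n
    induction n with
    | zero => simp
    | succ n ih =>
      intro x hx
      rw [birkhoffSum_succ', birkhoffSum_succ', ih _ ((hmem x).2 hx), hh, indicator_of_mem hx]
  have hout : ∀ n, ∀ x, x ∉ A → maxBirkhoff T h n x = 0 := by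
    intro n
    induction n with
    | zero => intro x _; rfl
    | succ n ih =>
      intro x hx
      have h3 : maxBirkhoff T h (n + 1) x = max 0 (h x + maxBirkhoff T h n (T x)) := rfl
      rw [h3, ih _ (fun h => hx ((hmem x).1 h)), hh, indicator_of_notMem hx]
      simp
  have hmono : Monotone fun n => {x | 0 < maxBirkhoff T h n x} :=
    monotone_nat_of_le_succ fun n x hx => lt_of_lt_of_le hx (maxBirkhoff_le_succ h n x)
  have hU : ⋃ n, {x | 0 < maxBirkhoff T h n x} = A := by
    ext x
    simp only [mem_iUnion, mem_ofPred_eq]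
    constructor
    · rintro ⟨n, hn⟩
      by_contra hx
      exact hn.ne' (hout n x hx)
    · intro hx
      obtain ⟨n, hn⟩ := hpos x hx
      refine ⟨n, lt_of_lt_of_le ?_ (birkhoffSum_le_maxBirkhoff h n x)⟩
      rwa [hin n x hx]
  have hlim := tendsto_setIntegral_of_monotone (μ := μ) (f := h)
    (s := fun n => {x | 0 < maxBirkhoff T h n x})
    (fun n => measurableSet_lt measurable_const (measurable_maxBirkhoff hT.measurable hhm n))
    hmono hhi.integrableOn
  have h0 := ge_of_tendsto' hlim fun n => setIntegral_maxBirkhoff_pos_nonneg hT hhi hhm n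
  rw [hU, hh, setIntegral_indicator hA, inter_self] at h0
  exact h0

theorem measurable_birkhoffSum (hT : Measurable T) {g : X → ℝ} (hg : Measurable g) (n : ℕ) :
    Measurable (birkhoffSum T g n) :=
  Finset.measurable_sum _ fun k _ => hg.comp (hT.iterate k)

/-- On the invariant set `A` of unbounded sums some sum is positive, so the maximal theorem gives `0
≤ ∫ (h - ε)` over `A`, which equals `-ε * μ.real A`. -/
theorem ae_bddAbove_birkhoffSum_sub [IsProbabilityMeasure μ] (hT : MeasurePreserving T μ μ)
    {h : X → ℝ} (hh : Integrable h μ) (hhm : Measurable h)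
    (hinv : ∀ A, MeasurableSet A → T ⁻¹' A = A → ∫ x in A, h x ∂μ = 0) {ε : ℝ} (hε : 0 < ε) :
    ∀ᵐ x ∂μ, BddAbove (range fun n => birkhoffSum T (fun x => h x - ε) n x) := by
  set g : X → ℝ := fun x => h x - ε with hg
  have hgi : Integrable g μ := hh.sub (integrable_const ε)
  have hgm : Measurable g := hhm.sub_const ε
  set A : Set X := {x | ¬ BddAbove (range fun n => birkhoffSum T g n x)} with hA
  have hAm : MeasurableSet A :=
    (measurableSet_bddAbove_range fun n => measurable_birkhoffSum hT.measurable hgm n).compl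
  have hTA : T ⁻¹' A = A := by
    ext x
    exact not_congr (bddAbove_birkhoffSum_comp_iff g x)
  have hpos : ∀ x ∈ A, ∃ n, 0 < birkhoffSum T g n x := by
    intro x hx
    by_contra hcon
    push Not at hcon
    exact hx ⟨0, by rintro _ ⟨n, rfl⟩; exact hcon n⟩
  have h1 := setIntegral_nonneg_of_exists_birkhoffSum_pos hT hgi hgm hAm hTA hpos
  rw [hg, integral_sub hh.integrableOn (integrable_const ε).integrableOn, hinv A hAm hTA,
    setIntegral_const, smul_eq_mul] at h1
  have h2 : μ.real A = 0 := by
    have : 0 ≤ μ.real A := measureReal_nonneg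
    nlinarith
  rw [measureReal_eq_zero_iff] at h2
  exact h2

theorem ae_eventually_birkhoffSum_le [IsProbabilityMeasure μ] (hT : MeasurePreserving T μ μ)
    {h : X → ℝ} (hh : Integrable h μ) (hhm : Measurable h)
    (hinv : ∀ A, MeasurableSet A → T ⁻¹' A = A → ∫ x in A, h x ∂μ = 0) :
    ∀ᵐ x ∂μ, ∀ ε > 0, ∀ᶠ n : ℕ in atTop, birkhoffSum T h n x ≤ ε * n := by
  have h1 : ∀ᵐ x ∂μ, ∀ k : ℕ,
      BddAbove (range fun n => birkhoffSum T (fun x => h x - 1 / ((k : ℝ) + 1)) n x) :=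
    ae_all_iff.2 fun k => ae_bddAbove_birkhoffSum_sub hT hh hhm hinv (by positivity)
  filter_upwards [h1] with x hx ε hε
  obtain ⟨k, hk⟩ := exists_nat_one_div_lt (half_pos hε)
  obtain ⟨K, hK⟩ := hx k
  filter_upwards [(tendsto_natCast_atTop_atTop (R := ℝ)).eventually_ge_atTop (K / (ε / 2))] with n hn
  have h2 := hK ⟨n, rfl⟩
  simp only [birkhoffSum_sub_const] at h2
  rw [div_le_iff₀ (half_pos hε)] at hn
  have h3 : (n : ℝ) * (1 / ((k : ℝ) + 1)) ≤ n * (ε / 2) := by gcongr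
  linarith

theorem ae_tendsto_birkhoffSum_div_zero [IsProbabilityMeasure μ] (hT : MeasurePreserving T μ μ)
    {h : X → ℝ} (hh : Integrable h μ)
    (hinv : ∀ A, MeasurableSet A → T ⁻¹' A = A → ∫ x in A, h x ∂μ = 0) :
    ∀ᵐ x ∂μ, Tendsto (fun n : ℕ => birkhoffSum T h n x / n) atTop (𝓝 0) := by
  -- A measurable representative agrees with `h` along the whole orbit of almost every point, since
  -- each iterate preserves `μ`.
  wlog hhm : Measurable h generalizing h
  · set h' := hh.aestronglyMeasurable.mk h with hh'
    have hae : h =ᵐ[μ] h' := hh.aestronglyMeasurable.ae_eq_mk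
    have h2 := this (h := h') (hh.congr hae) (fun A hA hTA => by
      rw [← hinv A hA hTA]
      exact setIntegral_congr_ae hA (hae.symm.mono fun x hx _ => hx))
      hh.aestronglyMeasurable.stronglyMeasurable_mk.measurable
    have h3 : ∀ᵐ x ∂μ, ∀ n : ℕ, h (T^[n] x) = h' (T^[n] x) :=
      ae_all_iff.2 fun n => (hT.iterate n).quasiMeasurePreserving.ae hae
    filter_upwards [h2, h3] with x hx hx3
    refine hx.congr fun n => ?_
    simp only [birkhoffSum, hx3]
  have h1 := ae_eventually_birkhoffSum_le hT hh hhm hinv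
  have h2 := ae_eventually_birkhoffSum_le hT hh.neg hhm.neg (fun A hA hTA => by
    simp only [Pi.neg_apply, integral_neg, hinv A hA hTA, neg_zero])
  filter_upwards [h1, h2] with x hx1 hx2
  rw [Metric.tendsto_nhds]
  intro ε hε
  filter_upwards [hx1 (ε / 2) (half_pos hε), hx2 (ε / 2) (half_pos hε), eventually_gt_atTop 0]
    with n hn1 hn2 hn
  have hn' : (0 : ℝ) < n := by exact_mod_cast hn
  have h3 : birkhoffSum T (-h) n x = - birkhoffSum T h n x := by
    simp [birkhoffSum]
  rw [h3] at hn2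
  rw [Real.dist_eq, sub_zero, abs_div, abs_of_pos hn', div_lt_iff₀ hn', abs_lt]
  constructor <;> nlinarith

/-- The sublevel sets at rational heights are almost invariant by measurability; countably many null
sets suffice to compare the two values. -/
theorem condExp_almostInvariants_comp [IsProbabilityMeasure μ] (f : X → ℝ) :
    ∀ᵐ x ∂μ, (μ[f | almostInvariants μ T]) (T x) = (μ[f | almostInvariants μ T]) x := by
  set E := μ[f | almostInvariants μ T] with hE
  have hm : Measurable[almostInvariants μ T] E := stronglyMeasurable_condExp.measurable
  have h1 : ∀ᵐ x ∂μ, ∀ q : ℚ, (E x < q ↔ E (T x) < q) := by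
    rw [ae_all_iff]
    intro q
    have h2 := (hm (measurableSet_Iio (a := (q : ℝ)))).2
    rw [measure_symmDiff_eq_zero_iff] at h2
    filter_upwards [h2.mem_iff] with x hx
    exact hx
  filter_upwards [h1] with x hx
  refine le_antisymm (le_of_forall_rat_lt_imp_le fun q hq => ?_)
    (le_of_forall_rat_lt_imp_le fun q hq => ?_)
  · by_contra hcon
    exact absurd ((hx q).1 (not_le.1 hcon)) (not_lt.2 hq.le)
  · by_contra hcon
    exact absurd ((hx q).2 (not_le.1 hcon)) (not_lt.2 hq.le)

theorem condExp_almostInvariants_iterate [IsProbabilityMeasure μ] (hT : MeasurePreserving T μ μ)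
    (f : X → ℝ) : ∀ᵐ x ∂μ, ∀ n : ℕ,
      (μ[f | almostInvariants μ T]) (T^[n] x) = (μ[f | almostInvariants μ T]) x := by
  have h1 : ∀ᵐ x ∂μ, ∀ n : ℕ, (μ[f | almostInvariants μ T]) (T (T^[n] x)) =
      (μ[f | almostInvariants μ T]) (T^[n] x) :=
    ae_all_iff.2 fun n =>
      (hT.iterate n).quasiMeasurePreserving.ae (condExp_almostInvariants_comp f)
  filter_upwards [h1] with x hx n
  induction n with
  | zero => rfl
  | succ n ih => rw [Function.iterate_succ_apply', hx n, ih]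

/-- Birkhoff's pointwise ergodic theorem, centred at the conditional expectation. -/
theorem ae_tendsto_birkhoffSum_sub_condExp [IsProbabilityMeasure μ]
    (hT : MeasurePreserving T μ μ) {f : X → ℝ} (hf : Integrable f μ) :
    ∀ᵐ x ∂μ, Tendsto (fun n : ℕ => (∑ k ∈ Finset.range n,
      (f (T^[k] x) - (μ[f | almostInvariants μ T]) x)) / n) atTop (𝓝 0) := by
  have h1 := ae_tendsto_birkhoffSum_div_zero hT
    (hf.sub (integrable_condExp (f := f) (m := almostInvariants μ T) (μ := μ)))
    (fun A hA hTA => by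
      -- Strictly invariant sets are almost invariant, so `f` minus its conditional expectation has
      -- zero integral on them.
      have hA' : MeasurableSet[almostInvariants μ T] A := ⟨hA, by rw [hTA]; simp⟩
      simp only [Pi.sub_apply]
      rw [integral_sub hf.integrableOn integrable_condExp.integrableOn,
        setIntegral_condExp (almostInvariants_le μ T) hf hA', sub_self])
  filter_upwards [h1, condExp_almostInvariants_iterate hT f] with x hx hx2
  refine hx.congr fun n => ?_
  simp only [birkhoffSum, Pi.sub_apply, hx2]

end Birkhoff

/-! ### Variation of products and of indicators of intervals. -/

section Variation

theorem eVariationOn_le_add {f g h : ℝ → ℝ} {s : Set ℝ}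
    (H : ∀ x ∈ s, ∀ y ∈ s, |h x - h y| ≤ |f x - f y| + |g x - g y|) :
    eVariationOn h s ≤ eVariationOn f s + eVariationOn g s := by
  refine iSup_le fun p => ?_
  obtain ⟨n, t, ht, hts⟩ := p
  calc ∑ i ∈ Finset.range n, edist (h (t (i + 1))) (h (t i))
      ≤ ∑ i ∈ Finset.range n,
        (edist (f (t (i + 1))) (f (t i)) + edist (g (t (i + 1))) (g (t i))) := by
        refine Finset.sum_le_sum fun i _ => ?_
        simp only [edist_dist, Real.dist_eq]
        rw [← ENNReal.ofReal_add (abs_nonneg _) (abs_nonneg _)]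
        exact ENNReal.ofReal_le_ofReal (H _ (hts _) _ (hts _))
    _ = _ := Finset.sum_add_distrib
    _ ≤ _ := add_le_add (eVariationOn.sum_le ht hts) (eVariationOn.sum_le ht hts)

theorem eVariationOn_mul_le {f g : ℝ → ℝ} {s : Set ℝ} (hf : ∀ x, |f x| ≤ 1)
    (hg : ∀ x, |g x| ≤ 1) :
    eVariationOn (fun x => f x * g x) s ≤ eVariationOn f s + eVariationOn g s := by
  refine eVariationOn_le_add fun x _ y _ => ?_
  have h1 : f x * g x - f y * g y = g x * (f x - f y) + f y * (g x - g y) := by ring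
  rw [h1]
  refine (abs_add_le _ _).trans (add_le_add ?_ ?_)
  · rw [abs_mul]
    exact mul_le_of_le_one_left (abs_nonneg _) (hg x)
  · rw [abs_mul]
    exact mul_le_of_le_one_left (abs_nonneg _) (hf y)

theorem eVariationOn_sub_const (f : ℝ → ℝ) (c : ℝ) (s : Set ℝ) :
    eVariationOn (fun x => f x - c) s = eVariationOn f s := by
  simp [eVariationOn]

theorem eVariationOn_indicator_isUpperSet_le {U : Set ℝ} (hU : IsUpperSet U) :
    eVariationOn (U.indicator fun _ => (1 : ℝ)) (Icc 0 1) ≤ 1 := by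
  have hm : MonotoneOn (U.indicator fun _ => (1 : ℝ)) (Icc 0 1) := by
    intro x _ y _ hxy
    by_cases hx : x ∈ U
    · rw [indicator_of_mem hx, indicator_of_mem (hU hxy hx)]
    · rw [indicator_of_notMem hx]
      exact indicator_nonneg (fun _ _ => zero_le_one) _
  have h := hm.eVariationOn_eq (left_mem_Icc.2 zero_le_one) (right_mem_Icc.2 zero_le_one)
  rw [inter_self] at h
  rw [h, ENNReal.ofReal_le_one]
  have h1 : U.indicator (fun _ => (1 : ℝ)) 1 ≤ 1 := indicator_le' (fun _ _ => le_rfl)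
    (fun _ _ => zero_le_one) _
  have h0 : 0 ≤ U.indicator (fun _ => (1 : ℝ)) 0 := indicator_nonneg (fun _ _ => zero_le_one) _
  linarith

/-- The upward closure `U` of `J` and, by order-connectedness, `U \ J` are upper sets. The indicator
of `J` is the difference of their monotone indicators, each of variation at most 1. -/
theorem eVariationOn_indicator_ordConnected_le {J : Set ℝ} (hJ : J.OrdConnected) :
    eVariationOn (J.indicator fun _ => (1 : ℝ)) (Icc 0 1) ≤ 2 := by
  set U : Set ℝ := {x | ∃ j ∈ J, j ≤ x} with hU
  have hUu : IsUpperSet U := fun x y hxy ⟨j, hj, hjx⟩ => ⟨j, hj, hjx.trans hxy⟩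
  have hDu : IsUpperSet (U \ J) := by
    rintro x y hxy ⟨⟨j, hj, hjx⟩, hx⟩
    exact ⟨⟨j, hj, hjx.trans hxy⟩, fun hy => hx (hJ.out hj hy ⟨hjx, hxy⟩)⟩
  have hJU : J ⊆ U := fun x hx => ⟨x, hx, le_rfl⟩
  have heq : ∀ x, J.indicator (fun _ => (1 : ℝ)) x =
      U.indicator (fun _ => (1 : ℝ)) x - (U \ J).indicator (fun _ => (1 : ℝ)) x := by
    intro x
    by_cases hx : x ∈ J
    · simp [hx, hJU hx]
    · by_cases hxU : x ∈ U <;> simp [hx, hxU]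
  calc _ ≤ eVariationOn (U.indicator fun _ => (1 : ℝ)) (Icc 0 1) +
        eVariationOn ((U \ J).indicator fun _ => (1 : ℝ)) (Icc 0 1) := by
        refine eVariationOn_le_add fun x _ y _ => ?_
        rw [heq, heq, sub_sub_sub_comm]
        exact abs_sub _ _
    _ ≤ 1 + 1 := add_le_add (eVariationOn_indicator_isUpperSet_le hUu)
        (eVariationOn_indicator_isUpperSet_le hDu)
    _ = 2 := one_add_one_eq_two

theorem eVariationOn_indicator_union_le (A B s : Set ℝ) :
    eVariationOn ((A ∪ B).indicator fun _ => (1 : ℝ)) s ≤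
      eVariationOn (A.indicator fun _ => (1 : ℝ)) s +
        eVariationOn (B.indicator fun _ => (1 : ℝ)) s := by
  refine eVariationOn_le_add fun x _ y _ => ?_
  by_cases h1 : x ∈ A <;> by_cases h2 : x ∈ B <;> by_cases h3 : y ∈ A <;> by_cases h4 : y ∈ B <;>
    simp [h1, h2, h3, h4]

theorem eVariationOn_indicator_biUnion_le {ι : Type*} (t : Finset ι) {J : ι → Set ℝ}
    (hJ : ∀ i, (J i).OrdConnected) :
    eVariationOn ((⋃ i ∈ t, J i).indicator fun _ => (1 : ℝ)) (Icc 0 1) ≤ 2 * t.card := by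
  classical
  induction t using Finset.induction_on with
  | empty => simp [eVariationOn]
  | insert i t hi ih =>
    rw [Finset.set_biUnion_insert, Finset.card_insert_of_notMem hi]
    refine (eVariationOn_indicator_union_le _ _ _).trans ?_
    refine (add_le_add (eVariationOn_indicator_ordConnected_le (hJ i)) ih).trans (le_of_eq ?_)
    push_cast
    ring

end Variation

/-! ### Hitting indicators and decorrelation at high frequency. -/

section Equidistribution

/-- The indicator function of `{y | fract (u * y) ∈ I}`. -/
noncomputable def hitIndicator (u : ℝ) (I : Set ℝ) (y : ℝ) : ℝ :=
  I.indicator (fun _ => 1) (Int.fract (u * y))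

theorem hitIndicator_nonneg (u : ℝ) (I : Set ℝ) (y : ℝ) : 0 ≤ hitIndicator u I y :=
  indicator_nonneg (fun _ _ => zero_le_one) _

theorem hitIndicator_le_one (u : ℝ) (I : Set ℝ) (y : ℝ) : hitIndicator u I y ≤ 1 :=
  indicator_le' (fun _ _ => le_rfl) (fun _ _ => zero_le_one) _

theorem IsUnionOfIntervals.measurableSet {ℓ : ℕ} {I : Set ℝ} (hI : IsUnionOfIntervals ℓ I) :
    MeasurableSet I := by
  obtain ⟨J, hJ, rfl⟩ := hI
  exact MeasurableSet.iUnion fun i => (hJ i).measurableSet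

theorem measurable_hitIndicator (u : ℝ) {I : Set ℝ} (hI : MeasurableSet I) :
    Measurable (hitIndicator u I) :=
  (measurable_const.indicator hI).comp (measurable_fract.comp (measurable_const_mul u))

/-- On `[0, 1]` the hitting set is a union of `ℓ * (⌊u⌋₊ + 1)` intervals, one for each value of the
integer part of `u * y` and each interval of `I`; each adds at most 2 to the variation. -/
theorem eVariationOn_hitIndicator_le {ℓ : ℕ} {I : Set ℝ} (hI : IsUnionOfIntervals ℓ I) {u : ℝ}
    (hu : 0 < u) :
    eVariationOn (hitIndicator u I) (Icc 0 1) ≤ ENNReal.ofReal (2 * ℓ * (u + 1)) := by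
  obtain ⟨J, hJ, rfl⟩ := hI
  set t : Finset (ℕ × Fin ℓ) := Finset.range (⌊u⌋₊ + 1) ×ˢ Finset.univ with ht
  set S : ℕ × Fin ℓ → Set ℝ := fun p => {y | ⌊u * y⌋ = (p.1 : ℤ) ∧ u * y - p.1 ∈ J p.2} with hS
  have hSo : ∀ p, (S p).OrdConnected := by
    intro p
    refine ⟨fun x hx y hy z hz => ⟨?_, ?_⟩⟩
    · refine le_antisymm ?_ ?_
      · rw [← hy.1]; exact Int.floor_mono (mul_le_mul_of_nonneg_left hz.2 hu.le)
      · rw [← hx.1]; exact Int.floor_mono (mul_le_mul_of_nonneg_left hz.1 hu.le)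
    · exact (hJ p.2).out hx.2 hy.2 ⟨sub_le_sub_right (mul_le_mul_of_nonneg_left hz.1 hu.le) _,
        sub_le_sub_right (mul_le_mul_of_nonneg_left hz.2 hu.le) _⟩
  have heq : EqOn (hitIndicator u (⋃ i, J i)) ((⋃ p ∈ t, S p).indicator fun _ => (1 : ℝ))
      (Icc 0 1) := by
    intro y hy
    have hiff : Int.fract (u * y) ∈ (⋃ i, J i) ↔ y ∈ ⋃ p ∈ t, S p := by
      simp only [mem_iUnion, hS, mem_ofPred_eq, exists_prop, Prod.exists, ht,
        Finset.mem_product, Finset.mem_range, Finset.mem_univ, and_true]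
      have h0 : 0 ≤ u * y := mul_nonneg hu.le hy.1
      constructor
      · rintro ⟨i, hi⟩
        have hfl : (⌊u * y⌋ : ℤ) = (⌊u * y⌋₊ : ℤ) := (Int.natCast_floor_eq_floor h0).symm
        refine ⟨⌊u * y⌋₊, i, ?_, hfl, ?_⟩
        · exact Nat.lt_succ_of_le (Nat.floor_mono (mul_le_of_le_one_right hu.le hy.2))
        · have : ((⌊u * y⌋₊ : ℕ) : ℝ) = ((⌊u * y⌋ : ℤ) : ℝ) := by rw [hfl]; simp
          rw [this]
          exact hi
      · rintro ⟨k, i, _, hfl, hi⟩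
        refine ⟨i, ?_⟩
        rw [Int.fract, hfl]
        exact_mod_cast hi
    by_cases h : y ∈ ⋃ p ∈ t, S p
    · rw [indicator_of_mem h, hitIndicator, indicator_of_mem (hiff.2 h)]
    · rw [indicator_of_notMem h, hitIndicator, indicator_of_notMem (fun h' => h (hiff.1 h'))]
  rw [eVariationOn.congr heq]
  refine (eVariationOn_indicator_biUnion_le t hSo).trans ?_
  have hcard : (2 : ℝ≥0∞) * (t.card : ℝ≥0∞) = ENNReal.ofReal (2 * (t.card : ℝ)) := by
    rw [ENNReal.ofReal_mul zero_le_two]; simp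
  rw [hcard]
  refine ENNReal.ofReal_le_ofReal ?_
  rw [ht, Finset.card_product, Finset.card_range, Finset.card_univ, Fintype.card_fin]
  push_cast
  have := Nat.floor_le hu.le
  have hl : (0 : ℝ) ≤ ℓ := Nat.cast_nonneg ℓ
  nlinarith

theorem integral_comp_mul_period {g : ℝ → ℝ} (hper : Function.Periodic g 1) {u : ℝ}
    (hu : 0 < u) (j : ℕ) :
    ∫ y in (j / u : ℝ)..((j + 1 : ℕ) / u), g (u * y) = u⁻¹ * ∫ y in (0 : ℝ)..1, g y := by
  rw [intervalIntegral.integral_comp_mul_left g hu.ne', smul_eq_mul,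
    mul_div_cancel₀ _ hu.ne', mul_div_cancel₀ _ hu.ne']
  have := hper.intervalIntegral_add_eq (j : ℝ) 0
  rw [zero_add] at this
  push_cast
  rw [this]

theorem intervalIntegrable_of_abs_le_one {f : ℝ → ℝ} (hf : Measurable f) (h : ∀ x, |f x| ≤ 1)
    (a b : ℝ) : IntervalIntegrable f volume a b :=
  (intervalIntegrable_const (c := (1 : ℝ))).mono_fun hf.aestronglyMeasurable
    (Eventually.of_forall fun x => by simpa using h x)

/-- A function of bounded variation is almost uncorrelated with a centred periodic function of
high frequency. -/
theorem abs_integral_mul_comp_mul_le {F g : ℝ → ℝ} (hF : Measurable F) (hg : Measurable g)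
    (hF1 : ∀ x, |F x| ≤ 1) (hg1 : ∀ x, |g x| ≤ 1) {V : ℝ} (hV : 0 ≤ V)
    (hFV : eVariationOn F (Icc 0 1) ≤ ENNReal.ofReal V) (hper : Function.Periodic g 1)
    (hg0 : ∫ y in (0 : ℝ)..1, g y = 0) {u : ℝ} (hu : 0 < u) :
    |∫ y in (0 : ℝ)..1, F y * g (u * y)| ≤ (V + 1) / u := by
  -- `[0, 1]` is cut into `m` full periods of length `1 / u` and a remainder of length at most `1 /
  -- u`; the remainder is the source of the `+ 1` in the bound.
  set m := ⌊u⌋₊ with hm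
  set a : ℕ → ℝ := fun j => j / u with ha
  have hamono : Monotone a := fun i j hij => by
    simp only [ha]
    gcongr
  have ham : a m ≤ 1 := (div_le_one hu).2 (Nat.floor_le hu.le)
  have ha0 : a 0 = 0 := by simp [ha]
  have hgu : Measurable fun y => g (u * y) := hg.comp (measurable_const_mul u)
  have hFg : Measurable fun y => F y * g (u * y) := hF.mul hgu
  have hFg1 : ∀ x, |F x * g (u * x)| ≤ 1 := fun x => by
    rw [abs_mul]; exact mul_le_one₀ (hF1 _) (abs_nonneg _) (hg1 _)
  have hint := intervalIntegrable_of_abs_le_one hFg hFg1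
  set v : ℕ → ℝ≥0∞ := fun j => eVariationOn F (Icc (a j) (a (j + 1))) with hv
  have hsum : ∑ j ∈ Finset.range m, v j ≤ ENNReal.ofReal V := by
    rw [hv, eVariationOn.sum' F hamono, ha0]
    exact (eVariationOn.mono F (Icc_subset_Icc_right ham)).trans hFV
  have hvfin : ∀ j ∈ Finset.range m, v j ≠ ∞ := fun j hj =>
    ((Finset.single_le_sum (fun _ _ => zero_le) hj).trans hsum).trans_lt ENNReal.ofReal_lt_top |>.ne
  have hsum' : ∑ j ∈ Finset.range m, (v j).toReal ≤ V := by
    rw [← ENNReal.toReal_sum hvfin]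
    exact ENNReal.toReal_le_of_le_ofReal hV hsum
  have hpiece : ∀ j ∈ Finset.range m,
      |∫ y in a j..a (j + 1), F y * g (u * y)| ≤ (v j).toReal / u := by
    intro j hj
    have hle : a j ≤ a (j + 1) := hamono (Nat.le_succ j)
    -- Since `g` has mean zero over a period, `F` may be replaced by its deviation from the left
    -- endpoint value, which is at most the local variation.
    have h0 : ∫ y in a j..a (j + 1), F (a j) * g (u * y) = 0 := by
      rw [intervalIntegral.integral_const_mul]
      simp only [ha]
      rw [integral_comp_mul_period hper hu, hg0]
      simp
    have h1 : ∫ y in a j..a (j + 1), F y * g (u * y) =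
        ∫ y in a j..a (j + 1), (F y - F (a j)) * g (u * y) := by
      simp only [sub_mul]
      rw [intervalIntegral.integral_sub (hint _ _)
        ((intervalIntegrable_of_abs_le_one hgu (fun x => hg1 _) _ _).const_mul _), h0, sub_zero]
    rw [h1, ← Real.norm_eq_abs]
    have hlen : |a (j + 1) - a j| = 1 / u := by
      rw [abs_of_nonneg (sub_nonneg.2 hle)]
      simp only [ha]
      push_cast
      field_simp
      ring
    have h2 := intervalIntegral.norm_integral_le_of_norm_le_const (a := a j) (b := a (j + 1))
      (f := fun y => (F y - F (a j)) * g (u * y)) (C := (v j).toReal) (fun y hy => by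
        rw [uIoc_of_le hle] at hy
        rw [norm_mul]
        refine (mul_le_of_le_one_right (norm_nonneg _) (hg1 _)).trans ?_
        have h3 := eVariationOn.edist_le F (s := Icc (a j) (a (j + 1))) (x := y) (y := a j)
          ⟨hy.1.le, hy.2⟩ (left_mem_Icc.2 hle)
        rw [edist_dist, Real.dist_eq] at h3
        exact (ENNReal.ofReal_le_iff_le_toReal (hvfin j hj)).1 h3)
    rw [hlen, mul_one_div] at h2
    exact h2
  have hlast : |∫ y in a m..1, F y * g (u * y)| ≤ 1 / u := by
    rw [← Real.norm_eq_abs]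
    refine (intervalIntegral.norm_integral_le_of_norm_le_const (C := 1)
      fun y _ => hFg1 y).trans ?_
    rw [one_mul, abs_of_nonneg (sub_nonneg.2 ham)]
    simp only [ha]
    rw [sub_le_iff_le_add, ← add_div, le_div_iff₀ hu]
    have := Nat.lt_floor_add_one u
    rw [← hm] at this
    linarith
  have hsplit : ∫ y in (0 : ℝ)..1, F y * g (u * y) =
      (∑ j ∈ Finset.range m, ∫ y in a j..a (j + 1), F y * g (u * y)) +
        ∫ y in a m..1, F y * g (u * y) := by
    rw [intervalIntegral.sum_integral_adjacent_intervals (fun k _ => hint _ _), ha0,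
      intervalIntegral.integral_add_adjacent_intervals (hint _ _) (hint _ _)]
  rw [hsplit]
  refine (abs_add_le _ _).trans ?_
  rw [add_div]
  refine add_le_add ?_ hlast
  refine (Finset.abs_sum_le_sum_abs _ _).trans ((Finset.sum_le_sum hpiece).trans ?_)
  rw [← Finset.sum_div]
  gcongr

theorem hitIndicator_one_periodic (I : Set ℝ) : Function.Periodic (hitIndicator 1 I) 1 := by
  intro x
  simp [hitIndicator]

theorem hitIndicator_one_mul (u : ℝ) (I : Set ℝ) (y : ℝ) :
    hitIndicator 1 I (u * y) = hitIndicator u I y := by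
  simp [hitIndicator]

theorem integral_hitIndicator_one {I : Set ℝ} (hI : MeasurableSet I) (hI1 : I ⊆ Icc 0 1) :
    ∫ y in (0 : ℝ)..1, hitIndicator 1 I y = volume.real I := by
  rw [intervalIntegral.integral_of_le zero_le_one, ← integral_Ico_eq_integral_Ioc,
    setIntegral_congr_fun (g := I.indicator fun _ => (1 : ℝ)) measurableSet_Ico (fun y hy => by
      simp only [hitIndicator, one_mul]
      rw [Int.fract_eq_self.2 hy]),
    integral_Ico_eq_integral_Ioc, ← integral_Icc_eq_integral_Ioc, setIntegral_indicator hI,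
    inter_eq_right.2 hI1]
  simp

/-- The interval `[0, 1]` is covered by `⌊u⌋₊ + 1` full periods, each contributing `volume.real I /
u`. -/
theorem integral_hitIndicator_le {I : Set ℝ} (hI : MeasurableSet I) (hI1 : I ⊆ Icc 0 1) {u : ℝ}
    (hu : 0 < u) :
    ∫ y in (0 : ℝ)..1, hitIndicator u I y ≤ (1 + 1 / u) * volume.real I := by
  have hmeas := measurable_hitIndicator u hI
  have h1 : ∀ x, |hitIndicator u I x| ≤ 1 := fun x => by
    rw [abs_of_nonneg (hitIndicator_nonneg _ _ _)]; exact hitIndicator_le_one _ _ _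
  have hint := intervalIntegrable_of_abs_le_one hmeas h1
  set m := ⌊u⌋₊ with hm
  have hlt : u < m + 1 := Nat.lt_floor_add_one u
  have hle : (1 : ℝ) ≤ ((m + 1 : ℕ) : ℝ) / u := by
    rw [le_div_iff₀ hu]; push_cast; linarith
  have hs : ∑ j ∈ Finset.range (m + 1), ∫ y in (j / u : ℝ)..((j + 1 : ℕ) / u), hitIndicator u I y =
      ∫ y in (0 : ℝ)..((m + 1 : ℕ) / u), hitIndicator u I y := by
    rw [intervalIntegral.sum_integral_adjacent_intervals (a := fun j : ℕ => (j / u : ℝ))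
      (fun k _ => hint _ _)]
    simp
  have hp : ∀ j : ℕ, ∫ y in (j / u : ℝ)..((j + 1 : ℕ) / u), hitIndicator u I y =
      u⁻¹ * volume.real I := fun j => by
    rw [← integral_hitIndicator_one hI hI1,
      ← integral_comp_mul_period (hitIndicator_one_periodic I) hu j]
    simp only [hitIndicator_one_mul]
  calc ∫ y in (0 : ℝ)..1, hitIndicator u I y
      ≤ ∫ y in (0 : ℝ)..((m + 1 : ℕ) / u), hitIndicator u I y := by
        refine intervalIntegral.integral_mono_interval le_rfl zero_le_one hle
          (Eventually.of_forall fun y => hitIndicator_nonneg _ _ _) (hint _ _)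
    _ = (m + 1) * (u⁻¹ * volume.real I) := by
        rw [← hs, Finset.sum_congr rfl fun j _ => hp j]; simp
    _ ≤ (u + 1) * (u⁻¹ * volume.real I) := by
        have := Nat.floor_le hu.le
        gcongr
    _ = _ := by field_simp

end Equidistribution

/-! ### Moment bounds for autocorrelations of nearly uncorrelated sequences. -/

section SecondMoment

/-- The weight `n ^ (-a)`, which vanishes at `n = 0` when `a ≠ 0`. -/
noncomputable def powWeight (a : ℝ) (n : ℕ) : ℝ := (n : ℝ) ^ (-a)

theorem powWeight_zero {a : ℝ} (ha : 0 < a) : powWeight a 0 = 0 := by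
  simp [powWeight, Real.zero_rpow (neg_ne_zero.2 ha.ne')]

theorem powWeight_nonneg (a : ℝ) (n : ℕ) : 0 ≤ powWeight a n :=
  Real.rpow_nonneg (Nat.cast_nonneg n) _

theorem powWeight_antitone {a : ℝ} (ha : 0 < a) {m n : ℕ} (hm : 1 ≤ m) (hmn : m ≤ n) :
    powWeight a n ≤ powWeight a m :=
  Real.rpow_le_rpow_of_nonpos (by exact_mod_cast hm) (by exact_mod_cast hmn) (by linarith)

theorem powWeight_le_one {a : ℝ} (ha : 0 < a) (n : ℕ) : powWeight a n ≤ 1 := by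
  rcases Nat.eq_zero_or_pos n with rfl | hn
  · rw [powWeight_zero ha]; exact zero_le_one
  · exact (powWeight_antitone ha le_rfl hn).trans (by simp [powWeight])

theorem powWeight_mul_le_sq {a : ℝ} (ha : 0 < a) (n m : ℕ) :
    powWeight a n * powWeight a (n + m) ≤ powWeight a n ^ 2 := by
  rcases Nat.eq_zero_or_pos n with rfl | hn
  · simp [powWeight_zero ha]
  · rw [sq]
    exact mul_le_mul_of_nonneg_left (powWeight_antitone ha hn (Nat.le_add_right _ _))
      (powWeight_nonneg _ _)

theorem powWeight_sq {a : ℝ} (n : ℕ) : powWeight a n ^ 2 = powWeight (2 * a) n := by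
  rw [powWeight, powWeight, ← Real.rpow_natCast, ← Real.rpow_mul (Nat.cast_nonneg n)]
  congr 1
  push_cast
  ring

theorem sum_powWeight_le {b : ℝ} (hb : 0 < b) (hb1 : b < 1) (N : ℕ) :
    ∑ n ∈ Finset.range N, powWeight b n ≤ (N : ℝ) ^ (1 - b) / (1 - b) := by
  have h1b : 0 < 1 - b := by linarith
  -- Including the term `n = N` lets the induction start from the vanishing weight at 0; the step is
  -- Bernoulli's inequality for `(1 - 1 / M) ^ (1 - b)`.
  have key : ∑ n ∈ Finset.range (N + 1), powWeight b n ≤ (N : ℝ) ^ (1 - b) / (1 - b) := by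
    induction N with
    | zero => simp [powWeight_zero hb, Real.zero_rpow h1b.ne']
    | succ N ih =>
      rw [Finset.sum_range_succ]
      refine (add_le_add ih le_rfl).trans ?_
      have hM : (0 : ℝ) < ((N + 1 : ℕ) : ℝ) := by positivity
      set M : ℝ := ((N + 1 : ℕ) : ℝ) with hMdef
      have hN : (N : ℝ) = M * (1 + (-(1 / M))) := by
        rw [hMdef]; push_cast; field_simp; ring
      have hMge : 1 ≤ M := by rw [hMdef]; push_cast; linarith [(Nat.cast_nonneg N : (0 : ℝ) ≤ N)]
      have hinv : 1 / M ≤ 1 := (div_le_one hM).2 hMge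
      have hbern := rpow_one_add_le_one_add_mul_self (s := -(1 / M)) (by linarith)
        (p := 1 - b) h1b.le (by linarith)
      have hNle : (N : ℝ) ^ (1 - b) ≤ M ^ (1 - b) * (1 + (1 - b) * -(1 / M)) := by
        rw [hN, Real.mul_rpow hM.le (by linarith)]
        exact mul_le_mul_of_nonneg_left hbern (Real.rpow_nonneg hM.le _)
      have hp : powWeight b (N + 1) = M ^ (1 - b) / M := by
        rw [powWeight, ← hMdef, sub_eq_neg_add, Real.rpow_add_one hM.ne', mul_div_cancel_right₀ _ hM.ne']
      rw [hp, ← sub_nonneg]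
      have : M ^ (1 - b) / (1 - b) - ((N : ℝ) ^ (1 - b) / (1 - b) + M ^ (1 - b) / M) =
        (M ^ (1 - b) * (1 + (1 - b) * -(1 / M)) - (N : ℝ) ^ (1 - b)) / (1 - b) := by
        field_simp
        ring
      rw [this]
      exact div_nonneg (sub_nonneg.2 hNle) h1b.le
  exact (Finset.sum_le_sum_of_subset_of_nonneg (Finset.range_mono (Nat.le_succ N))
    fun _ _ _ => powWeight_nonneg _ _).trans key

/-- The sum of the absolute values of the autocorrelations of the first `N` terms of `Y`. -/
noncomputable def autocorrelationSum (Y : ℕ → ℝ) (N : ℕ) : ℝ :=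
  ∑ m ∈ Finset.range N, |∑ n ∈ Finset.range (N - m), Y n * Y (n + m)|

theorem autocorrelationSum_nonneg (Y : ℕ → ℝ) (N : ℕ) : 0 ≤ autocorrelationSum Y N :=
  Finset.sum_nonneg fun _ _ => abs_nonneg _

variable {Ω : Type*} [MeasurableSpace Ω]

/-- A sequence of random variables with values in `[0, 1]` and means of order `n ^ (-a)`, in which
terms at distance at least `N ^ κ` among the first `N` are nearly uncorrelated. -/
structure IsNearlyUncorrelated (ν : Measure Ω) (X : ℕ → Ω → ℝ) (a κ C K : ℝ) (N₀ : ℕ) : Prop where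
  measurable : ∀ n, Measurable (X n)
  nonneg : ∀ n y, 0 ≤ X n y
  le_one : ∀ n y, X n y ≤ 1
  zero : ∀ y, X 0 y = 0
  integral_le : ∀ n, ∫ y, X n y ∂ν ≤ C * powWeight a n
  abs_integral_mul_le : ∀ N ≥ N₀, ∀ i p : ℕ, p < N → (i : ℝ) + (N : ℝ) ^ κ ≤ p →
    |∫ y, X i y * (X p y - powWeight a p) ∂ν| ≤ K / (N : ℝ) ^ 2
  abs_integral_mul_mul_le : ∀ N ≥ N₀, ∀ i j k p : ℕ, p < N → (i : ℝ) + (N : ℝ) ^ κ ≤ p →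
    (j : ℝ) + (N : ℝ) ^ κ ≤ p → (k : ℝ) + (N : ℝ) ^ κ ≤ p →
    |∫ y, (X i y - powWeight a i) * (X j y - powWeight a j) * (X k y - powWeight a k) *
      (X p y - powWeight a p) ∂ν| ≤ K / (N : ℝ) ^ 2

namespace IsNearlyUncorrelated

variable {ν : Measure Ω} {X : ℕ → Ω → ℝ} {a κ C K : ℝ} {N₀ : ℕ}

theorem abs_sub_le_one (hX : IsNearlyUncorrelated ν X a κ C K N₀) (ha : 0 < a) (n : ℕ) (y : Ω) :
    |X n y - powWeight a n| ≤ 1 := by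
  have h1 := hX.nonneg n y
  have h2 := hX.le_one n y
  have h3 := powWeight_nonneg a n
  have h4 := powWeight_le_one ha n
  rw [abs_le]; constructor <;> linarith

theorem abs_sub_le_add (hX : IsNearlyUncorrelated ν X a κ C K N₀) (n : ℕ) (y : Ω) :
    |X n y - powWeight a n| ≤ X n y + powWeight a n := by
  have h1 := hX.nonneg n y
  have h3 := powWeight_nonneg a n
  rw [abs_le]; constructor <;> linarith

theorem measurable_sub (hX : IsNearlyUncorrelated ν X a κ C K N₀) (n : ℕ) :
    Measurable fun y => X n y - powWeight a n :=
  (hX.measurable n).sub_const _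

theorem measurable_mul (hX : IsNearlyUncorrelated ν X a κ C K N₀) (n p : ℕ) :
    Measurable fun y => (X n y - powWeight a n) * (X p y - powWeight a p) :=
  (hX.measurable_sub n).mul (hX.measurable_sub p)

theorem abs_mul_le_one (hX : IsNearlyUncorrelated ν X a κ C K N₀) (ha : 0 < a) (n p : ℕ) (y : Ω) :
    |(X n y - powWeight a n) * (X p y - powWeight a p)| ≤ 1 := by
  rw [abs_mul]
  exact mul_le_one₀ (hX.abs_sub_le_one ha n y) (abs_nonneg _) (hX.abs_sub_le_one ha p y)

theorem card_filter_dist_lt_le (L n : ℕ) {H : ℝ} (hH : 0 ≤ H) :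
    (((Finset.range L).filter fun n' : ℕ => |(n : ℝ) - n'| < H).card : ℝ) ≤ 2 * H + 1 := by
  have hsub : ((Finset.range L).filter fun n' : ℕ => |(n : ℝ) - n'| < H) ⊆
      Finset.Icc (n - ⌊H⌋₊) (n + ⌊H⌋₊) := by
    intro k hk
    rw [Finset.mem_filter, abs_lt] at hk
    rw [Finset.mem_Icc]
    have h1 := Nat.lt_floor_add_one H
    constructor
    · have : (n : ℝ) < k + ⌊H⌋₊ + 1 := by linarith [hk.2.2]
      have : n < k + ⌊H⌋₊ + 1 := by exact_mod_cast this
      omega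
    · have : (k : ℝ) < n + ⌊H⌋₊ + 1 := by linarith [hk.2.1]
      have : k < n + ⌊H⌋₊ + 1 := by exact_mod_cast this
      omega
  have h2 := Finset.card_le_card hsub
  rw [Nat.card_Icc] at h2
  have h3 : ((Finset.range L).filter fun n' : ℕ => |(n : ℝ) - n'| < H).card ≤ 2 * ⌊H⌋₊ + 1 := by
    omega
  have h4 := Nat.floor_le hH
  have h5 : (((Finset.range L).filter fun n' : ℕ => |(n : ℝ) - n'| < H).card : ℝ) ≤
      2 * ⌊H⌋₊ + 1 := by exact_mod_cast h3
  linarith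

/-- The largest of the four indices is `max n n' + m`. It exceeds the other three by at least `N ^
κ`, because both `m` and the distance of `n` and `n'` do. -/
theorem abs_integral_mul_mul_le_of_gap (hX : IsNearlyUncorrelated ν X a κ C K N₀) {N : ℕ}
    (hN : N₀ ≤ N) {n n' m : ℕ} (hm : (N : ℝ) ^ κ ≤ m) (hnm : n + m < N) (hnm' : n' + m < N)
    (hgap : (N : ℝ) ^ κ ≤ |(n : ℝ) - n'|) :
    |∫ y, ((X n y - powWeight a n) * (X (n + m) y - powWeight a (n + m))) *
      ((X n' y - powWeight a n') * (X (n' + m) y - powWeight a (n' + m))) ∂ν| ≤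
      K / (N : ℝ) ^ 2 := by
  have hm0 : (0 : ℝ) ≤ m := Nat.cast_nonneg m
  rcases le_total n n' with h | h
  · have h' : (n : ℝ) ≤ n' := by exact_mod_cast h
    rw [abs_of_nonpos (by linarith)] at hgap
    have := hX.abs_integral_mul_mul_le N hN n (n + m) n' (n' + m) hnm'
      (by push_cast; linarith) (by push_cast; linarith) (by push_cast; linarith)
    refine le_trans (le_of_eq ?_) this
    congr 1
    refine integral_congr_ae (Eventually.of_forall fun y => ?_)
    ring
  · have h' : (n' : ℝ) ≤ n := by exact_mod_cast h
    rw [abs_of_nonneg (by linarith)] at hgap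
    have := hX.abs_integral_mul_mul_le N hN n' (n' + m) n (n + m) hnm
      (by push_cast; linarith) (by push_cast; linarith) (by push_cast; linarith)
    refine le_trans (le_of_eq ?_) this
    congr 1
    refine integral_congr_ae (Eventually.of_forall fun y => ?_)
    ring

variable [IsProbabilityMeasure ν]

theorem integrable_of_abs_le {f : Ω → ℝ} (hf : Measurable f) {c : ℝ} (h : ∀ y, |f y| ≤ c) :
    Integrable f ν :=
  Integrable.of_bound hf.aestronglyMeasurable c (Eventually.of_forall h)

theorem integrable (hX : IsNearlyUncorrelated ν X a κ C K N₀) (n : ℕ) : Integrable (X n) ν :=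
  integrable_of_abs_le (hX.measurable n) fun y => by
    rw [abs_of_nonneg (hX.nonneg n y)]; exact hX.le_one n y

theorem integral_abs_sub_le (hX : IsNearlyUncorrelated ν X a κ C K N₀) (ha : 0 < a) (n : ℕ) :
    ∫ y, |X n y - powWeight a n| ∂ν ≤ (C + 1) * powWeight a n := by
  have h1 : Integrable (fun y => |X n y - powWeight a n|) ν :=
    (integrable_of_abs_le (hX.measurable_sub n) (hX.abs_sub_le_one ha n)).abs
  calc ∫ y, |X n y - powWeight a n| ∂ν ≤ ∫ y, (X n y + powWeight a n) ∂ν :=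
        integral_mono h1 ((hX.integrable n).add (integrable_const _)) (hX.abs_sub_le_add n)
    _ = ∫ y, X n y ∂ν + powWeight a n := by
        rw [integral_add (hX.integrable n) (integrable_const _)]; simp
    _ ≤ _ := by linarith [hX.integral_le n]

theorem integral_abs_mul_le_fst (hX : IsNearlyUncorrelated ν X a κ C K N₀) (ha : 0 < a)
    (n p : ℕ) :
    ∫ y, |(X n y - powWeight a n) * (X p y - powWeight a p)| ∂ν ≤ (C + 1) * powWeight a n := by
  refine (integral_mono (integrable_of_abs_le (hX.measurable_mul n p)
    (hX.abs_mul_le_one ha n p)).abs (integrable_of_abs_le (hX.measurable_sub n)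
    (hX.abs_sub_le_one ha n)).abs fun y => ?_).trans (hX.integral_abs_sub_le ha n)
  simp only [abs_mul]
  exact mul_le_of_le_one_right (abs_nonneg _) (hX.abs_sub_le_one ha p y)

theorem integral_abs_mul_le_of_gap (hX : IsNearlyUncorrelated ν X a κ C K N₀) (ha : 0 < a)
    (hC : 0 ≤ C) {N : ℕ} (hN : N₀ ≤ N) {n m : ℕ} (hm : (N : ℝ) ^ κ ≤ m) (hnm : n + m < N) :
    ∫ y, |(X n y - powWeight a n) * (X (n + m) y - powWeight a (n + m))| ∂ν ≤
      (3 * C + 1) * powWeight a n ^ 2 + K / (N : ℝ) ^ 2 := by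
  set p := n + m with hp
  set s := powWeight a n with hs
  set t := powWeight a p with ht
  have hs0 : 0 ≤ s := powWeight_nonneg _ _
  have ht0 : 0 ≤ t := powWeight_nonneg _ _
  have hst : s * t ≤ s ^ 2 := powWeight_mul_le_sq ha n m
  have hi1 : Integrable (fun y => X n y * (X p y - t)) ν :=
    integrable_of_abs_le ((hX.measurable n).mul (hX.measurable_sub p)) (c := 1) fun y => by
      rw [abs_mul, abs_of_nonneg (hX.nonneg n y)]
      exact mul_le_one₀ (hX.le_one n y) (abs_nonneg _) (hX.abs_sub_le_one ha p y)
  have hi2 : Integrable (fun y => 2 * t * X n y) ν := (hX.integrable n).const_mul _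
  have hi3 : Integrable (fun y => s * X p y) ν := (hX.integrable p).const_mul _
  have hi12 : Integrable (fun y => X n y * (X p y - t) + 2 * t * X n y) ν := hi1.add hi2
  have hi123 : Integrable (fun y => X n y * (X p y - t) + 2 * t * X n y + s * X p y) ν :=
    hi12.add hi3
  -- The product `(X n + s) * (X p + t)` is rearranged so that the only product of two variables has
  -- a centred factor `X p - t`; the other terms integrate to `O(s * t)`.
  have hpt : ∀ y, |(X n y - s) * (X p y - t)| ≤
      X n y * (X p y - t) + 2 * t * X n y + s * X p y + s * t := by
    intro y
    rw [abs_mul]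
    refine (mul_le_mul (hX.abs_sub_le_add n y) (hX.abs_sub_le_add p y) (abs_nonneg _)
      (add_nonneg (hX.nonneg n y) hs0)).trans (le_of_eq ?_)
    ring
  have h1 := (le_abs_self _).trans (hX.abs_integral_mul_le N hN n p hnm (by
    rw [hp]; push_cast; linarith))
  calc _ ≤ ∫ y, (X n y * (X p y - t) + 2 * t * X n y + s * X p y + s * t) ∂ν :=
        integral_mono (integrable_of_abs_le (hX.measurable_mul n p)
          (hX.abs_mul_le_one ha n p)).abs (hi123.add (integrable_const _)) hpt
    _ = ∫ y, X n y * (X p y - t) ∂ν + 2 * t * ∫ y, X n y ∂ν + s * ∫ y, X p y ∂ν + s * t := by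
        rw [integral_add hi123 (integrable_const _), integral_add hi12 hi3, integral_add hi1 hi2,
          integral_const_mul, integral_const_mul]
        simp
    _ ≤ K / (N : ℝ) ^ 2 + 2 * t * (C * s) + s * (C * t) + s * t := by
        gcongr
        · exact hX.integral_le n
        · exact hX.integral_le p
    _ = (3 * C + 1) * (s * t) + K / (N : ℝ) ^ 2 := by ring
    _ ≤ _ := by gcongr

/-- After expanding the square, pairs at distance at least `N ^ κ` contribute `O(N ^ (-2))` each.
Every `n` has `O(N ^ κ)` close partners, each costing at most the first absolute moment of the
`n`-th term, of order `n ^ (-2 * a)` up to `O(N ^ (-2))`. -/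
theorem integral_sq_sum_le (hX : IsNearlyUncorrelated ν X a κ C K N₀) (ha : 0 < a)
    (ha2 : 2 * a < 1) (hκ : 0 ≤ κ) (hC : 0 ≤ C) (hK : 0 ≤ K) {N : ℕ} (hN : N₀ ≤ N) (hN1 : 1 ≤ N)
    {m : ℕ} (hm : (N : ℝ) ^ κ ≤ m) :
    ∫ y, (∑ n ∈ Finset.range (N - m),
      (X n y - powWeight a n) * (X (n + m) y - powWeight a (n + m))) ^ 2 ∂ν ≤
      (4 * K + 3 * (3 * C + 1) / (1 - 2 * a)) * ((N : ℝ) ^ κ * (N : ℝ) ^ (1 - 2 * a)) := by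
  set L := N - m with hL
  set Z : ℕ → Ω → ℝ :=
    fun n y => (X n y - powWeight a n) * (X (n + m) y - powWeight a (n + m)) with hZ
  set H := (N : ℝ) ^ κ with hH
  have hNr : (1 : ℝ) ≤ N := by exact_mod_cast hN1
  have hH1 : 1 ≤ H := Real.one_le_rpow hNr hκ
  have hP1 : 1 ≤ (N : ℝ) ^ (1 - 2 * a) := Real.one_le_rpow hNr (by linarith)
  have hZm : ∀ n, Measurable (Z n) := fun n => hX.measurable_mul n (n + m)
  have hZ1 : ∀ n y, |Z n y| ≤ 1 := fun n => hX.abs_mul_le_one ha n (n + m)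
  have hZZ1 : ∀ n n' y, |Z n y * Z n' y| ≤ 1 := fun n n' y => by
    rw [abs_mul]; exact mul_le_one₀ (hZ1 _ _) (abs_nonneg _) (hZ1 _ _)
  have hZZ : ∀ n n', Integrable (fun y => Z n y * Z n' y) ν := fun n n' =>
    integrable_of_abs_le ((hZm n).mul (hZm n')) (hZZ1 n n')
  have hKN : 0 ≤ K / (N : ℝ) ^ 2 := by positivity
  set D : ℕ → ℝ := fun n => (3 * C + 1) * powWeight a n ^ 2 + K / (N : ℝ) ^ 2 with hD
  have hD0 : ∀ n, 0 ≤ D n := fun n => by simp only [hD]; positivity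
  have hterm : ∀ n ∈ Finset.range L, ∀ n' ∈ Finset.range L, ∫ y, Z n y * Z n' y ∂ν ≤
      K / (N : ℝ) ^ 2 + if |(n : ℝ) - n'| < H then D n else 0 := by
    intro n hn n' hn'
    rw [Finset.mem_range] at hn hn'
    split_ifs with h
    · refine le_trans ?_ (le_add_of_nonneg_left hKN)
      refine le_trans ?_ (hX.integral_abs_mul_le_of_gap ha hC hN hm (n := n) (by omega))
      refine integral_mono (hZZ n n') (integrable_of_abs_le (hZm n) (hZ1 n)).abs fun y => ?_
      refine (le_abs_self _).trans ?_
      simp only [abs_mul (Z n y)]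
      exact mul_le_of_le_one_right (abs_nonneg _) (hZ1 n' y)
    · rw [add_zero]
      exact (le_abs_self _).trans
        (hX.abs_integral_mul_mul_le_of_gap hN hm (by omega) (by omega) (not_lt.1 h))
  have hexp : ∫ y, (∑ n ∈ Finset.range L, Z n y) ^ 2 ∂ν =
      ∑ n ∈ Finset.range L, ∑ n' ∈ Finset.range L, ∫ y, Z n y * Z n' y ∂ν := by
    simp only [sq, Finset.sum_mul_sum]
    rw [integral_finsetSum _ fun n _ => integrable_finsetSum _ fun n' _ => hZZ n n']
    exact Finset.sum_congr rfl fun n _ => integral_finsetSum _ fun n' _ => hZZ n n'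
  have hLN : (L : ℝ) ≤ N := by exact_mod_cast Nat.sub_le N m
  have hL0 : (0 : ℝ) ≤ L := Nat.cast_nonneg L
  have hsumD : ∑ n ∈ Finset.range L, D n ≤
      (3 * C + 1) * ((N : ℝ) ^ (1 - 2 * a) / (1 - 2 * a)) + K := by
    simp only [hD, Finset.sum_add_distrib, ← Finset.mul_sum, powWeight_sq]
    refine add_le_add ?_ ?_
    · refine mul_le_mul_of_nonneg_left ?_ (by linarith)
      exact (Finset.sum_le_sum_of_subset_of_nonneg (Finset.range_mono (Nat.sub_le N m))
        fun _ _ _ => powWeight_nonneg _ _).trans (sum_powWeight_le (by linarith) ha2 N)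
    · rw [Finset.sum_const, Finset.card_range, nsmul_eq_mul, mul_div_assoc', div_le_iff₀ (by positivity)]
      have h1 : (L : ℝ) ≤ (N : ℝ) ^ 2 := hLN.trans (le_self_pow₀ hNr two_ne_zero)
      nlinarith
  rw [hexp]
  calc _ ≤ ∑ n ∈ Finset.range L, ∑ n' ∈ Finset.range L,
        (K / (N : ℝ) ^ 2 + if |(n : ℝ) - n'| < H then D n else 0) :=
        Finset.sum_le_sum fun n hn => Finset.sum_le_sum fun n' hn' => hterm n hn n' hn'
    _ ≤ ∑ n ∈ Finset.range L, (K / (N : ℝ) + 3 * H * D n) := by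
        refine Finset.sum_le_sum fun n _ => ?_
        rw [Finset.sum_add_distrib, ← Finset.sum_filter, Finset.sum_const, Finset.sum_const,
          Finset.card_range, nsmul_eq_mul, nsmul_eq_mul]
        refine add_le_add ?_ (mul_le_mul_of_nonneg_right ?_ (hD0 n))
        · calc (L : ℝ) * (K / (N : ℝ) ^ 2) ≤ N * (K / (N : ℝ) ^ 2) := by gcongr
            _ = K / N := by field_simp
        · exact (card_filter_dist_lt_le L n (by linarith)).trans (by linarith)
    _ = L * (K / N) + 3 * H * ∑ n ∈ Finset.range L, D n := by
        rw [Finset.sum_add_distrib, ← Finset.mul_sum]; simp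
    _ ≤ K + 3 * H * ((3 * C + 1) * ((N : ℝ) ^ (1 - 2 * a) / (1 - 2 * a)) + K) := by
        refine add_le_add ?_ (mul_le_mul_of_nonneg_left hsumD (by linarith))
        calc (L : ℝ) * (K / N) ≤ N * (K / N) := by gcongr
          _ = K := by field_simp
    _ ≤ K * (H * (N : ℝ) ^ (1 - 2 * a)) + 3 * (K * (H * (N : ℝ) ^ (1 - 2 * a))) +
        3 * H * ((3 * C + 1) * ((N : ℝ) ^ (1 - 2 * a) / (1 - 2 * a))) := by
        have h1 : 1 ≤ H * (N : ℝ) ^ (1 - 2 * a) := one_le_mul_of_one_le_of_one_le hH1 hP1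
        have h2 : H ≤ H * (N : ℝ) ^ (1 - 2 * a) := le_mul_of_one_le_right (by linarith) hP1
        have h3 := mul_le_mul_of_nonneg_left h1 hK
        have h4 := mul_le_mul_of_nonneg_left h2 hK
        linarith
    _ = _ := by ring

/-- Shifts `m ≥ N ^ κ` use the second moment bound. The at most `2 * N ^ κ` smaller shifts use the
trivial bound `O(N ^ (1 - a))`, which is affordable because `κ ≤ 1`. -/
theorem integral_autocorrelationSum_le (hX : IsNearlyUncorrelated ν X a κ C K N₀) (ha : 0 < a)
    (ha2 : 2 * a < 1) (hκ : 0 ≤ κ) (hκ1 : κ ≤ 1) (hC : 0 ≤ C) (hK : 0 ≤ K) {N : ℕ}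
    (hN : N₀ ≤ N) (hN1 : 1 ≤ N) :
    ∫ y, autocorrelationSum (fun n => X n y - powWeight a n) N ∂ν ≤
      (4 * K + 3 * (3 * C + 1) / (1 - 2 * a) + 1 + 2 * ((C + 1) / (1 - a))) *
        (N : ℝ) ^ ((3 + κ) / 2 - a) := by
  set B := 4 * K + 3 * (3 * C + 1) / (1 - 2 * a) with hB
  set Z : ℕ → ℕ → Ω → ℝ :=
    fun m n y => (X n y - powWeight a n) * (X (n + m) y - powWeight a (n + m)) with hZ
  set R : ℕ → Ω → ℝ := fun m y => ∑ n ∈ Finset.range (N - m), Z m n y with hR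
  have hNr : (1 : ℝ) ≤ N := by exact_mod_cast hN1
  have hN0 : (0 : ℝ) < N := by linarith
  have hZm : ∀ m n, Measurable (Z m n) := fun m n => hX.measurable_mul n (n + m)
  have hZ1 : ∀ m n y, |Z m n y| ≤ 1 := fun m n => hX.abs_mul_le_one ha n (n + m)
  have hRm : ∀ m, Measurable (R m) := fun m => Finset.measurable_fun_sum _ fun n _ => hZm m n
  have hR1 : ∀ m y, |R m y| ≤ N := fun m y => by
    refine (Finset.abs_sum_le_sum_abs _ _).trans ((Finset.sum_le_sum fun n _ => hZ1 m n y).trans ?_)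
    simp
  have hRi : ∀ m, Integrable (fun y => |R m y|) ν := fun m =>
    (integrable_of_abs_le (hRm m) (hR1 m)).abs
  have hRi2 : ∀ m, Integrable (fun y => R m y ^ 2) ν := fun m =>
    integrable_of_abs_le ((hRm m).pow_const 2) (c := (N : ℝ) ^ 2) fun y => by
      rw [abs_pow]; exact pow_le_pow_left₀ (abs_nonneg _) (hR1 m y) 2
  set t := (N : ℝ) ^ ((1 + κ) / 2 - a) with ht
  have ht0 : 0 < t := Real.rpow_pos_of_pos hN0 _
  have htt : (N : ℝ) ^ κ * (N : ℝ) ^ (1 - 2 * a) = t * t := by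
    rw [ht, ← Real.rpow_add hN0, ← Real.rpow_add hN0]; congr 1; ring
  have h1a : 0 < 1 - a := by linarith
  have hB0 : 0 ≤ B := by
    have : 0 < 1 - 2 * a := by linarith
    positivity
  have hfar : ∀ m : ℕ, (N : ℝ) ^ κ ≤ m → ∫ y, |R m y| ∂ν ≤ (B + 1) * t := by
    intro m hm
    have h1 := hX.integral_sq_sum_le ha ha2 hκ hC hK hN hN1 hm
    rw [htt] at h1
    -- With `t` the square root of the size of the second moment, this replaces the Cauchy–Schwarz
    -- inequality.
    have h2 : ∀ y, |R m y| ≤ R m y ^ 2 * t⁻¹ + t := by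
      intro y
      rw [← sub_nonneg, ← sq_abs (R m y)]
      have : |R m y| ^ 2 * t⁻¹ + t - |R m y| =
        ((|R m y| - t / 2) ^ 2 + 3 / 4 * t ^ 2) * t⁻¹ := by field_simp; ring
      rw [this]
      positivity
    calc ∫ y, |R m y| ∂ν ≤ ∫ y, (R m y ^ 2 * t⁻¹ + t) ∂ν :=
          integral_mono (hRi m) (((hRi2 m).mul_const _).add (integrable_const _)) h2
      _ = (∫ y, R m y ^ 2 ∂ν) * t⁻¹ + t := by
          rw [integral_add ((hRi2 m).mul_const _) (integrable_const _), integral_mul_const]; simp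
      _ ≤ B * (t * t) * t⁻¹ + t := by gcongr
      _ = _ := by field_simp
  have hnear : ∀ m, ∫ y, |R m y| ∂ν ≤ (C + 1) / (1 - a) * (N : ℝ) ^ (1 - a) := by
    intro m
    have hZi : ∀ n, Integrable (fun y => |Z m n y|) ν := fun n =>
      (integrable_of_abs_le (hZm m n) (hZ1 m n)).abs
    calc ∫ y, |R m y| ∂ν ≤ ∫ y, ∑ n ∈ Finset.range (N - m), |Z m n y| ∂ν :=
          integral_mono (hRi m) (integrable_finsetSum _ fun n _ => hZi n)
            fun y => Finset.abs_sum_le_sum_abs _ _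
      _ = ∑ n ∈ Finset.range (N - m), ∫ y, |Z m n y| ∂ν := integral_finsetSum _ fun n _ => hZi n
      _ ≤ ∑ n ∈ Finset.range (N - m), (C + 1) * powWeight a n :=
          Finset.sum_le_sum fun n _ => hX.integral_abs_mul_le_fst ha n (n + m)
      _ ≤ ∑ n ∈ Finset.range N, (C + 1) * powWeight a n :=
          Finset.sum_le_sum_of_subset_of_nonneg (Finset.range_mono (Nat.sub_le N m))
            fun _ _ _ => mul_nonneg (by linarith) (powWeight_nonneg _ _)
      _ = (C + 1) * ∑ n ∈ Finset.range N, powWeight a n := by rw [Finset.mul_sum]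
      _ ≤ (C + 1) * ((N : ℝ) ^ (1 - a) / (1 - a)) := by
          gcongr
          exact sum_powWeight_le ha (by linarith) N
      _ = _ := by ring
  have hcard : (((Finset.range N).filter fun m : ℕ => ¬ (N : ℝ) ^ κ ≤ m).card : ℝ) ≤
      2 * (N : ℝ) ^ κ := by
    have hH1 : 1 ≤ (N : ℝ) ^ κ := Real.one_le_rpow hNr hκ
    have hsub : ((Finset.range N).filter fun m : ℕ => ¬ (N : ℝ) ^ κ ≤ m) ⊆
        Finset.range (⌊(N : ℝ) ^ κ⌋₊ + 1) := by
      intro m hm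
      rw [Finset.mem_filter, not_le] at hm
      exact Finset.mem_range.2 (Nat.lt_succ_of_le (Nat.le_floor hm.2.le))
    have h2 := Finset.card_le_card hsub
    rw [Finset.card_range] at h2
    have h3 : (((Finset.range N).filter fun m : ℕ => ¬ (N : ℝ) ^ κ ≤ m).card : ℝ) ≤
      ⌊(N : ℝ) ^ κ⌋₊ + 1 := by exact_mod_cast h2
    linarith [Nat.floor_le (by linarith : 0 ≤ (N : ℝ) ^ κ)]
  have hint : ∫ y, autocorrelationSum (fun n => X n y - powWeight a n) N ∂ν =
      ∑ m ∈ Finset.range N, ∫ y, |R m y| ∂ν := integral_finsetSum _ fun m _ => hRi m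
  rw [hint, ← Finset.sum_filter_add_sum_filter_not (Finset.range N)
    (fun m : ℕ => (N : ℝ) ^ κ ≤ m)]
  have hS1 : ∑ m ∈ (Finset.range N).filter (fun m : ℕ => (N : ℝ) ^ κ ≤ m), ∫ y, |R m y| ∂ν ≤
      (B + 1) * (N : ℝ) ^ ((3 + κ) / 2 - a) := by
    refine (Finset.sum_le_card_nsmul _ _ ((B + 1) * t) fun m hm =>
      hfar m (Finset.mem_filter.1 hm).2).trans ?_
    rw [nsmul_eq_mul]
    have hc : (((Finset.range N).filter fun m : ℕ => (N : ℝ) ^ κ ≤ m).card : ℝ) ≤ N := by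
      exact_mod_cast (Finset.card_filter_le _ _).trans (Finset.card_range N).le
    have h1 : (N : ℝ) ^ ((3 + κ) / 2 - a) = N * t := by
      rw [ht, ← Real.rpow_one_add' hN0.le]
      · congr 1; ring
      · intro h; linarith
    rw [h1]
    calc _ ≤ (N : ℝ) * ((B + 1) * t) := by gcongr
      _ = _ := by ring
  have hS2 : ∑ m ∈ (Finset.range N).filter (fun m : ℕ => ¬ (N : ℝ) ^ κ ≤ m), ∫ y, |R m y| ∂ν ≤
      2 * ((C + 1) / (1 - a)) * (N : ℝ) ^ ((3 + κ) / 2 - a) := by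
    refine (Finset.sum_le_card_nsmul _ _ _ fun m _ => hnear m).trans ?_
    rw [nsmul_eq_mul]
    have h1 : (N : ℝ) ^ κ * (N : ℝ) ^ (1 - a) ≤ (N : ℝ) ^ ((3 + κ) / 2 - a) := by
      rw [← Real.rpow_add hN0]
      exact Real.rpow_le_rpow_of_exponent_le hNr (by linarith)
    calc _ ≤ 2 * (N : ℝ) ^ κ * ((C + 1) / (1 - a) * (N : ℝ) ^ (1 - a)) := by gcongr
      _ = 2 * ((C + 1) / (1 - a)) * ((N : ℝ) ^ κ * (N : ℝ) ^ (1 - a)) := by ring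
      _ ≤ _ := by gcongr
  calc _ ≤ _ := add_le_add hS1 hS2
    _ = _ := by ring

end IsNearlyUncorrelated

end SecondMoment

/-! ### Sublacunary growth and near-independence of the hitting events. -/

section Sublacunary

theorem IsSublacunary.le_succ {δ : ℝ} {u : ℕ → ℝ} (hu : IsSublacunary δ u) {n : ℕ} (hn : 1 ≤ n) :
    u n ≤ u (n + 1) := by
  obtain ⟨hpos, c, hc, -, h⟩ := hu
  have h1 := h n hn
  rw [le_div_iff₀ (hpos n hn)] at h1
  have h2 : 0 ≤ c * (n : ℝ) ^ (-δ) := mul_nonneg hc.le (Real.rpow_nonneg (Nat.cast_nonneg n) _)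
  nlinarith [hpos n hn]

theorem IsSublacunary.one_le {δ : ℝ} {u : ℕ → ℝ} (hu : IsSublacunary δ u) {n : ℕ} (hn : 1 ≤ n) :
    u 1 ≤ u n := by
  induction n, hn using Nat.le_induction with
  | base => exact le_rfl
  | succ n hn ih => exact ih.trans (hu.le_succ hn)

theorem exp_half_le_one_add {x : ℝ} (hx0 : 0 ≤ x) (hx1 : x ≤ 1) : Real.exp (x / 2) ≤ 1 + x := by
  have h1 := Real.add_one_le_exp (-(x / 2))
  have h2 : Real.exp (x / 2) * Real.exp (-(x / 2)) = 1 := by rw [← Real.exp_add]; simp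
  have h3 := Real.exp_pos (x / 2)
  nlinarith

/-- Terms of a `δ`-sublacunary sequence with indices at most `N` and at distance at least `N ^ κ`,
`κ > δ`, have ratio at most `N ^ (-2)`. -/
theorem IsSublacunary.exists_div_le {δ κ : ℝ} {u : ℕ → ℝ} (hu : IsSublacunary δ u) (hδ : 0 ≤ δ)
    (hκ : δ < κ) : ∃ N₀ : ℕ, 1 ≤ N₀ ∧ ∀ N ≥ N₀, ∀ q p : ℕ, 1 ≤ q → p < N →
      (q : ℝ) + (N : ℝ) ^ κ ≤ p → u q / u p ≤ 1 / (N : ℝ) ^ 2 := by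
  obtain ⟨hpos, c, hc, hc1, h⟩ := hu
  have hε : 0 < κ - δ := by linarith
  have hlim : Tendsto (fun N : ℕ => (N : ℝ) ^ (κ - δ)) atTop atTop :=
    (tendsto_rpow_atTop hε).comp tendsto_natCast_atTop_atTop
  -- The exponent `2 / (κ - δ)` is chosen so that, evaluated at `N ^ (κ - δ)`, the power equals `N ^
  -- 2`.
  have hev := hlim.eventually
    ((isLittleO_rpow_exp_pos_mul_atTop (2 / (κ - δ)) (half_pos hc)).bound zero_lt_one)
  obtain ⟨N₀, hN₀⟩ := eventually_atTop.1 hev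
  refine ⟨max N₀ 1, le_max_right _ _, fun N hN q p hq hp hqp => ?_⟩
  have hN1 : 1 ≤ N := (le_max_right _ _).trans hN
  have hNr : (1 : ℝ) ≤ N := by exact_mod_cast hN1
  have hN0 : (0 : ℝ) < N := by linarith
  have h1 := hN₀ N ((le_max_left _ _).trans hN)
  rw [one_mul, Real.norm_of_nonneg (Real.exp_pos _).le, ← Real.rpow_mul hN0.le,
    mul_div_cancel₀ _ hε.ne', Real.norm_of_nonneg (Real.rpow_nonneg hN0.le _)] at h1
  -- A lower bound for all relative increments up to index `N`. Over at least `N ^ κ` steps they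
  -- compound to `exp (c / 2 * N ^ (κ - δ)) ≥ N ^ 2`.
  set x := c * (N : ℝ) ^ (-δ) with hx
  have hx0 : 0 ≤ x := mul_nonneg hc.le (Real.rpow_nonneg hN0.le _)
  have hx1 : x ≤ 1 := mul_le_one₀ hc1.le (Real.rpow_nonneg hN0.le _)
    (Real.rpow_le_one_of_one_le_of_nonpos hNr (by linarith))
  have hgrow : ∀ k : ℕ, q + k ≤ N → (1 + x) ^ k * u q ≤ u (q + k) := by
    intro k
    induction k with
    | zero => intro _; simp
    | succ k ih =>
      intro hk
      have hqk : 1 ≤ q + k := by omega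
      have h2 := h (q + k) hqk
      rw [le_div_iff₀ (hpos _ hqk)] at h2
      have h3 : x ≤ c * ((q + k : ℕ) : ℝ) ^ (-δ) :=
        mul_le_mul_of_nonneg_left (Real.rpow_le_rpow_of_nonpos (by exact_mod_cast hqk)
          (by exact_mod_cast (by omega : q + k ≤ N)) (by linarith)) hc.le
      calc (1 + x) ^ (k + 1) * u q = (1 + x) * ((1 + x) ^ k * u q) := by ring
        _ ≤ (1 + x) * u (q + k) := by gcongr; exact ih (by omega)
        _ ≤ (1 + c * ((q + k : ℕ) : ℝ) ^ (-δ)) * u (q + k) := by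
            have := hpos _ hqk
            gcongr
        _ ≤ u (q + (k + 1)) := h2
  have hκ0 : 0 ≤ (N : ℝ) ^ κ := Real.rpow_nonneg hN0.le _
  have hqp' : q ≤ p := by
    have : (q : ℝ) ≤ p := by linarith
    exact_mod_cast this
  obtain ⟨k, rfl⟩ := Nat.exists_eq_add_of_le hqp'
  have hk : (N : ℝ) ^ κ ≤ k := by push_cast at hqp; linarith
  have hqpos := hpos q hq
  have hppos := hpos (q + k) (by omega)
  have hpow : (N : ℝ) ^ 2 ≤ (1 + x) ^ k := by
    calc (N : ℝ) ^ 2 = (N : ℝ) ^ (2 : ℝ) := by norm_cast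
      _ ≤ Real.exp (c / 2 * (N : ℝ) ^ (κ - δ)) := h1
      _ = Real.exp (x / 2 * (N : ℝ) ^ κ) := by
          rw [hx, sub_eq_add_neg, Real.rpow_add hN0]; ring_nf
      _ ≤ Real.exp (x / 2 * k) := by gcongr
      _ = Real.exp (x / 2) ^ k := by rw [← Real.exp_nat_mul]; ring_nf
      _ ≤ (1 + x) ^ k := by gcongr; exact exp_half_le_one_add hx0 hx1
  have hfin := hgrow k (by omega)
  rw [div_le_div_iff₀ hppos (by positivity), one_mul]
  nlinarith

/-- The indicator functions of the events `fract (u n * y) ∈ I n`, `n ≥ 1`. -/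
noncomputable def hitSequence (u : ℕ → ℝ) (I : ℕ → Set ℝ) (n : ℕ) (y : ℝ) : ℝ :=
  if n = 0 then 0 else hitIndicator (u n) (I n) y

theorem hitSequence_of_one_le (u : ℕ → ℝ) (I : ℕ → Set ℝ) {n : ℕ} (hn : 1 ≤ n) :
    hitSequence u I n = hitIndicator (u n) (I n) := by
  funext y
  rw [hitSequence, if_neg (by omega)]

theorem hitSequence_eq_indicator (u : ℕ → ℝ) (I : ℕ → Set ℝ) (n : ℕ) (y : ℝ) :
    hitSequence u I n y = (hittingSet u I y).indicator (fun _ => 1) n := by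
  classical
  by_cases hn : n = 0
  · subst hn
    simp [hitSequence, hittingSet]
  · have hn' : 1 ≤ n := by omega
    by_cases h : Int.fract (u n * y) ∈ I n
    · simp [hitSequence, hn, hitIndicator, h, hittingSet, hn', indicator]
    · simp [hitSequence, hn, hitIndicator, h, hittingSet]

variable {a δ κ : ℝ} {u : ℕ → ℝ} {I : ℕ → Set ℝ} {ℓ : ℕ}

/-- The product of the factors of smaller index has variation `O(u i + u j + u k + 1)`, and
integrating it against the centred factor of frequency `u p` gains `1 / u p`. Separation by `N ^ κ`
makes each ratio at most `N ^ (-2)` up to a constant. -/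
theorem isNearlyUncorrelated_hitSequence (ha : 0 < a) (hδ : 0 ≤ δ) (hκ : δ < κ)
    (hu : IsSublacunary δ u) (hI_subset : ∀ n : ℕ, 1 ≤ n → I n ⊆ Icc (0 : ℝ) 1)
    (hI_intervals : ∀ n : ℕ, 1 ≤ n → IsUnionOfIntervals ℓ (I n))
    (hI_measure : ∀ n : ℕ, 1 ≤ n → volume (I n) = ENNReal.ofReal ((n : ℝ) ^ (-a))) :
    ∃ C K : ℝ, 0 ≤ C ∧ 0 ≤ K ∧ ∃ N₀ : ℕ, IsNearlyUncorrelated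
      (volume.restrict (Ioc (0 : ℝ) 1)) (hitSequence u I) a κ C K N₀ := by
  obtain ⟨N₀, hN₀1, hN₀⟩ := hu.exists_div_le hδ hκ
  have hu1 : 0 < u 1 := hu.1 1 le_rfl
  have hl0 : (0 : ℝ) ≤ ℓ := Nat.cast_nonneg ℓ
  -- Chosen so that `u q + 1 ≤ b * u q` for all `q ≥ 1`, as `u` is nondecreasing from index 1; it
  -- also dominates the factor `1 + 1 / u n` in the mean.
  set b : ℝ := 1 + 1 / u 1 with hb
  have hb0 : 0 ≤ b := by positivity
  have hvol : ∀ n, 1 ≤ n → volume.real (I n) = powWeight a n := fun n hn => by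
    rw [measureReal_def, hI_measure n hn, ENNReal.toReal_ofReal (Real.rpow_nonneg (by positivity) _),
      powWeight]
  have hX0 : ∀ y, hitSequence u I 0 y = 0 := fun y => by simp [hitSequence]
  have hXm : ∀ n, Measurable (hitSequence u I n) := by
    intro n
    rcases Nat.eq_zero_or_pos n with rfl | hn
    · rw [show hitSequence u I 0 = fun _ => 0 from funext hX0]
      exact measurable_const
    · rw [hitSequence_of_one_le u I hn]
      exact measurable_hitIndicator _ (hI_intervals n hn).measurableSet
  have hXnn : ∀ n y, 0 ≤ hitSequence u I n y := fun n y => by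
    rw [hitSequence]; split_ifs
    exacts [le_rfl, hitIndicator_nonneg _ _ _]
  have hXle : ∀ n y, hitSequence u I n y ≤ 1 := fun n y => by
    rw [hitSequence]; split_ifs
    exacts [zero_le_one, hitIndicator_le_one _ _ _]
  have hYle : ∀ n y, |hitSequence u I n y - powWeight a n| ≤ 1 := fun n y => by
    have h1 := hXnn n y
    have h2 := hXle n y
    have h3 := powWeight_nonneg a n
    have h4 := powWeight_le_one ha n
    rw [abs_le]; constructor <;> linarith
  have hvar : ∀ n, 1 ≤ n → eVariationOn (hitSequence u I n) (Icc 0 1) ≤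
      ENNReal.ofReal (2 * ℓ * (u n + 1)) := fun n hn => by
    rw [hitSequence_of_one_le u I hn]
    exact eVariationOn_hitIndicator_le (hI_intervals n hn) (hu.1 n hn)
  have hcorr : ∀ p, 1 ≤ p → ∀ F : ℝ → ℝ, Measurable F → (∀ y, |F y| ≤ 1) → ∀ V : ℝ, 0 ≤ V →
      eVariationOn F (Icc 0 1) ≤ ENNReal.ofReal V →
      |∫ y in Ioc (0 : ℝ) 1, F y * (hitSequence u I p y - powWeight a p)| ≤ (V + 1) / u p := by
    intro p hp F hF hF1 V hV hFV
    have hIm := (hI_intervals p hp).measurableSet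
    have h1 := abs_integral_mul_comp_mul_le hF
      ((measurable_hitIndicator 1 hIm).sub_const (powWeight a p)) hF1 (fun x => by
        have := hYle p (x / u p)
        rwa [hitSequence_of_one_le u I hp, ← hitIndicator_one_mul,
          mul_div_cancel₀ _ (hu.1 p hp).ne'] at this) hV hFV
      (fun x => by simp only [hitIndicator_one_periodic (I p) x]) (by
        rw [intervalIntegral.integral_sub
          (intervalIntegrable_of_abs_le_one (measurable_hitIndicator 1 hIm) (fun x => by
            rw [abs_of_nonneg (hitIndicator_nonneg _ _ _)]; exact hitIndicator_le_one _ _ _) _ _)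
          intervalIntegrable_const, integral_hitIndicator_one hIm (hI_subset p hp), hvol p hp]
        simp) (hu.1 p hp)
    rw [intervalIntegral.integral_of_le zero_le_one] at h1
    simpa only [hitIndicator_one_mul, hitSequence_of_one_le u I hp] using h1
  have hratio : ∀ N ≥ N₀, ∀ q p : ℕ, 1 ≤ q → p < N → (q : ℝ) + (N : ℝ) ^ κ ≤ p →
      (u q + 1) / u p ≤ b / (N : ℝ) ^ 2 ∧ 1 / u p ≤ b / (N : ℝ) ^ 2 := by
    intro N hN q p hq hp hqp
    have hNpos : (0 : ℝ) < N := by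
      have : 1 ≤ N := hN₀1.trans hN
      exact_mod_cast this
    have hqp' : q ≤ p := by
      have : (q : ℝ) ≤ p := by linarith [Real.rpow_nonneg hNpos.le κ]
      exact_mod_cast this
    have hup := hu.1 p (hq.trans hqp')
    have h1 := hN₀ N hN q p hq hp hqp
    have hle : u q + 1 ≤ b * u q := by
      have : 1 ≤ 1 / u 1 * u q := by
        rw [div_mul_eq_mul_div, one_mul, one_le_div hu1]; exact hu.one_le hq
      rw [hb]; linarith
    have h2 : (u q + 1) / u p ≤ b / (N : ℝ) ^ 2 := by
      calc (u q + 1) / u p ≤ b * u q / u p := by gcongr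
        _ = b * (u q / u p) := by ring
        _ ≤ b * (1 / (N : ℝ) ^ 2) := by gcongr
        _ = _ := by ring
    refine ⟨h2, le_trans ?_ h2⟩
    gcongr
    linarith [hu.1 q hq]
  -- In `6 * ℓ + 1`, three factors contribute variation `2 * ℓ` each and the incomplete period
  -- contributes 1; the two-factor estimate needs only `2 * ℓ + 1`.
  refine ⟨b, (6 * ℓ + 1) * b, hb0, by positivity, N₀, hXm, hXnn, hXle, hX0, ?_, ?_, ?_⟩
  · intro n
    rcases Nat.eq_zero_or_pos n with rfl | hn
    · simp [hX0, powWeight_zero ha]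
    · rw [hitSequence_of_one_le u I hn, ← intervalIntegral.integral_of_le zero_le_one, ← hvol n hn]
      refine (integral_hitIndicator_le (hI_intervals n hn).measurableSet (hI_subset n hn)
        (hu.1 n hn)).trans ?_
      have := one_div_le_one_div_of_le hu1 (hu.one_le hn)
      gcongr
      rw [hb]; linarith
  · intro N hN i p hp hip
    have hNpos : (0 : ℝ) < N := by
      have : 1 ≤ N := hN₀1.trans hN
      exact_mod_cast this
    rcases Nat.eq_zero_or_pos i with rfl | hi
    · simp only [hX0, zero_mul, integral_zero, abs_zero]
      positivity
    have hip' : i ≤ p := by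
      have : (i : ℝ) ≤ p := by linarith [Real.rpow_nonneg hNpos.le κ]
      exact_mod_cast this
    have hui := hu.1 i hi
    obtain ⟨hr1, hr2⟩ := hratio N hN i p hi hp hip
    refine (hcorr p (Nat.le_trans hi hip') _ (hXm i) (fun y => by
      rw [abs_of_nonneg (hXnn i y)]; exact hXle i y) _ (by positivity) (hvar i hi)).trans ?_
    calc (2 * ℓ * (u i + 1) + 1) / u p = 2 * ℓ * ((u i + 1) / u p) + 1 / u p := by ring
      _ ≤ 2 * ℓ * (b / (N : ℝ) ^ 2) + b / (N : ℝ) ^ 2 := by gcongr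
      _ ≤ 6 * ℓ * (b / (N : ℝ) ^ 2) + b / (N : ℝ) ^ 2 := by gcongr; norm_num
      _ = _ := by ring
  · intro N hN i j k p hp hip hjp hkp
    have hNpos : (0 : ℝ) < N := by
      have : 1 ≤ N := hN₀1.trans hN
      exact_mod_cast this
    -- Index 0, where `u` is uncontrolled, drops out because the variable and its weight both vanish
    -- there.
    have hzero : ∀ y, hitSequence u I 0 y - powWeight a 0 = 0 := fun y => by
      rw [hX0, powWeight_zero ha, sub_zero]
    rcases Nat.eq_zero_or_pos i with rfl | hi
    · simp only [hzero, zero_mul, integral_zero, abs_zero]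
      positivity
    rcases Nat.eq_zero_or_pos j with rfl | hj
    · simp only [hzero, mul_zero, zero_mul, integral_zero, abs_zero]
      positivity
    rcases Nat.eq_zero_or_pos k with rfl | hk
    · simp only [hzero, mul_zero, zero_mul, integral_zero, abs_zero]
      positivity
    have hip' : i ≤ p := by
      have : (i : ℝ) ≤ p := by linarith [Real.rpow_nonneg hNpos.le κ]
      exact_mod_cast this
    have hui := hu.1 i hi
    have huj := hu.1 j hj
    have huk := hu.1 k hk
    obtain ⟨hr1, hr4⟩ := hratio N hN i p hi hp hip
    obtain ⟨hr2, -⟩ := hratio N hN j p hj hp hjp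
    obtain ⟨hr3, -⟩ := hratio N hN k p hk hp hkp
    have hYm : ∀ n, Measurable fun y => hitSequence u I n y - powWeight a n :=
      fun n => (hXm n).sub_const _
    have hY2 : ∀ y, |(hitSequence u I i y - powWeight a i) *
        (hitSequence u I j y - powWeight a j)| ≤ 1 := fun y => by
      rw [abs_mul]; exact mul_le_one₀ (hYle _ _) (abs_nonneg _) (hYle _ _)
    have hvar3 : eVariationOn (fun y => (hitSequence u I i y - powWeight a i) *
        (hitSequence u I j y - powWeight a j) * (hitSequence u I k y - powWeight a k)) (Icc 0 1) ≤
        ENNReal.ofReal (2 * ℓ * (u i + 1) + 2 * ℓ * (u j + 1) + 2 * ℓ * (u k + 1)) := by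
      rw [ENNReal.ofReal_add (by positivity) (by positivity),
        ENNReal.ofReal_add (by positivity) (by positivity)]
      refine (eVariationOn_mul_le hY2 (hYle k)).trans (add_le_add
        ((eVariationOn_mul_le (hYle i) (hYle j)).trans (add_le_add ?_ ?_)) ?_)
      · rw [eVariationOn_sub_const]; exact hvar i hi
      · rw [eVariationOn_sub_const]; exact hvar j hj
      · rw [eVariationOn_sub_const]; exact hvar k hk
    refine (hcorr p (Nat.le_trans hi hip') _ (((hYm i).mul (hYm j)).mul (hYm k)) (fun y => by
      simp only [Pi.mul_apply]
      rw [abs_mul]; exact mul_le_one₀ (hY2 _) (abs_nonneg _) (hYle _ _)) _ (by positivity)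
      hvar3).trans ?_
    calc (2 * ℓ * (u i + 1) + 2 * ℓ * (u j + 1) + 2 * ℓ * (u k + 1) + 1) / u p
        = 2 * ℓ * ((u i + 1) / u p) + 2 * ℓ * ((u j + 1) / u p) + 2 * ℓ * ((u k + 1) / u p) +
          1 / u p := by ring
      _ ≤ 2 * ℓ * (b / (N : ℝ) ^ 2) + 2 * ℓ * (b / (N : ℝ) ^ 2) + 2 * ℓ * (b / (N : ℝ) ^ 2) +
          b / (N : ℝ) ^ 2 := by gcongr
      _ = _ := by ring

end Sublacunary

/-! ### From moment bounds to almost sure summability. -/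

section AlmostSure

/-- By Tonelli the sum has finite integral, hence is finite almost everywhere. -/
theorem ae_summable_of_summable_integral {Ω : Type*} [MeasurableSpace Ω] {ν : Measure Ω}
    {f : ℕ → Ω → ℝ} (hf0 : ∀ n y, 0 ≤ f n y) (hf : ∀ n, Integrable (f n) ν)
    (hs : Summable fun n => ∫ y, f n y ∂ν) : ∀ᵐ y ∂ν, Summable fun n => f n y := by
  have h1 : ∫⁻ y, ∑' n, ENNReal.ofReal (f n y) ∂ν ≠ ∞ := by
    rw [lintegral_tsum fun n => (hf n).aestronglyMeasurable.aemeasurable.ennreal_ofReal]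
    have h2 : ∀ n, ∫⁻ y, ENNReal.ofReal (f n y) ∂ν = ENNReal.ofReal (∫ y, f n y ∂ν) := fun n =>
      (ofReal_integral_eq_lintegral_ofReal (hf n) (Eventually.of_forall (hf0 n))).symm
    simp only [h2]
    exact hs.tsum_ofReal_ne_top
  have h3 := ae_lt_top' (AEMeasurable.tsum fun n =>
    (hf n).aestronglyMeasurable.aemeasurable.ennreal_ofReal) h1
  filter_upwards [h3] with y hy
  refine (ENNReal.summable_toReal hy.ne).congr fun n => ?_
  rw [ENNReal.toReal_ofReal (hf0 n y)]

variable {Ω : Type*} [MeasurableSpace Ω] {ν : Measure Ω} [IsProbabilityMeasure ν]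
  {X : ℕ → Ω → ℝ} {a κ C K : ℝ} {N₀ : ℕ}

theorem IsNearlyUncorrelated.exists_ae_summable (hX : IsNearlyUncorrelated ν X a κ C K N₀)
    (ha : 0 < a) (hκ : 0 ≤ κ) (haκ : 2 * a + κ < 1) (hC : 0 ≤ C) (hK : 0 ≤ K) :
    ∃ s : ℕ, 1 ≤ s ∧ ∀ᵐ y ∂ν, Summable fun k : ℕ =>
      autocorrelationSum (fun n => X n y - powWeight a n) (k ^ s) /
        ((k ^ s : ℕ) : ℝ) ^ (2 - 2 * a) := by
  -- The power saved: `2 - 2 * a` minus the exponent `(3 + κ) / 2 - a` of the moment bound. With `s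
  -- ≥ 2 / η`, the saving along `N = k ^ s` is at least `k ^ 2`.
  set η := (1 - κ - 2 * a) / 2 with hη
  have hη0 : 0 < η := by rw [hη]; linarith
  obtain ⟨s, hs⟩ := exists_nat_ge (2 / η)
  have hs1 : 1 ≤ s := by
    by_contra h
    have : s = 0 := by omega
    subst this
    have : 0 < 2 / η := by positivity
    simp only [Nat.cast_zero] at hs
    linarith
  refine ⟨s, hs1, ?_⟩
  set B := 4 * K + 3 * (3 * C + 1) / (1 - 2 * a) + 1 + 2 * ((C + 1) / (1 - a)) with hB
  have hB0 : 0 ≤ B := by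
    have : 0 < 1 - 2 * a := by linarith
    have : 0 < 1 - a := by linarith
    positivity
  have hint : ∀ N : ℕ, Integrable
      (fun y => autocorrelationSum (fun n => X n y - powWeight a n) N) ν := fun N =>
    integrable_finsetSum _ fun m _ => (integrable_finsetSum _ fun n _ =>
      IsNearlyUncorrelated.integrable_of_abs_le (hX.measurable_mul n (n + m))
        (hX.abs_mul_le_one ha n (n + m))).abs
  refine ae_summable_of_summable_integral
    (fun k y => div_nonneg (autocorrelationSum_nonneg _ _) (Real.rpow_nonneg (Nat.cast_nonneg _) _))
    (fun k => (hint _).div_const _) ?_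
  have hsum : Summable fun k : ℕ => B * (1 / (k : ℝ) ^ 2) :=
    (Real.summable_one_div_nat_pow.2 one_lt_two).mul_left B
  refine Summable.of_norm_bounded_eventually_nat hsum ?_
  filter_upwards [eventually_ge_atTop (max N₀ 1)] with k hk
  have hk1 : 1 ≤ k := (le_max_right _ _).trans hk
  have hkr : (1 : ℝ) ≤ k := by exact_mod_cast hk1
  have hk0 : (0 : ℝ) < k := by linarith
  set N := k ^ s with hN
  have hNk : k ≤ N := Nat.le_self_pow (by omega) k
  have hN0 : (0 : ℝ) < (N : ℝ) := by
    have : 0 < N := lt_of_lt_of_le hk1 hNk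
    exact_mod_cast this
  rw [integral_div, Real.norm_of_nonneg (div_nonneg
    (integral_nonneg fun y => autocorrelationSum_nonneg _ _) (Real.rpow_nonneg hN0.le _))]
  have h1 := hX.integral_autocorrelationSum_le ha (by linarith) hκ (by linarith) hC hK
    (((le_max_left _ _).trans hk).trans hNk) (hk1.trans hNk)
  calc _ ≤ B * (N : ℝ) ^ ((3 + κ) / 2 - a) / (N : ℝ) ^ (2 - 2 * a) := by gcongr
    _ = B * (N : ℝ) ^ (-η) := by
        rw [mul_div_assoc, ← Real.rpow_sub hN0]
        congr 2
        ring
    _ = B * (k : ℝ) ^ (-(s * η)) := by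
        rw [hN, Nat.cast_pow, ← Real.rpow_natCast, ← Real.rpow_mul hk0.le, mul_neg]
    _ ≤ B * (k : ℝ) ^ (-2 : ℝ) := by
        rw [div_le_iff₀ hη0] at hs
        gcongr
    _ = _ := by
        rw [Real.rpow_neg hk0.le, one_div]; norm_cast

end AlmostSure

/-! ### Sums of the weights and weighted Cesàro averages. -/

section Weights

/-- The partial sums of the weights `n ^ (-a)`. -/
noncomputable def weightSum (a : ℝ) (N : ℕ) : ℝ := ∑ n ∈ Finset.range N, powWeight a n

theorem weightSum_mono (a : ℝ) : Monotone (weightSum a) := fun _ _ h =>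
  Finset.sum_le_sum_of_subset_of_nonneg (Finset.range_mono h) fun _ _ _ => powWeight_nonneg _ _

theorem weightSum_nonneg (a : ℝ) (N : ℕ) : 0 ≤ weightSum a N :=
  Finset.sum_nonneg fun _ _ => powWeight_nonneg _ _

/-- The weights decrease from index 1 on; one term is lost because the weight at 0 vanishes. -/
theorem sub_one_mul_powWeight_le_weightSum {a : ℝ} (ha : 0 < a) {N M : ℕ}
    (hNM : N ≤ M + 1) : ((N : ℝ) - 1) * powWeight a M ≤ weightSum a N := by
  induction N with
  | zero =>
    simp only [Nat.cast_zero, zero_sub]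
    exact (by linarith [powWeight_nonneg a M] : -1 * powWeight a M ≤ 0).trans
      (weightSum_nonneg a 0)
  | succ N ih =>
    have h1 := ih (by omega)
    rw [weightSum, Finset.sum_range_succ, ← weightSum]
    rcases Nat.eq_zero_or_pos N with rfl | hN
    · simp [powWeight_zero ha, weightSum]
    · have h2 := powWeight_antitone ha hN (by omega : N ≤ M)
      push_cast
      linarith

theorem half_rpow_le_weightSum {a : ℝ} (ha : 0 < a) {N : ℕ} (hN : 2 ≤ N) :
    (N : ℝ) ^ (1 - a) / 2 ≤ weightSum a N := by
  refine le_trans ?_ (sub_one_mul_powWeight_le_weightSum ha (Nat.le_succ N))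
  have hN2 : (2 : ℝ) ≤ N := by exact_mod_cast hN
  have h1 : (N : ℝ) ^ (1 - a) = N * powWeight a N := by
    rw [powWeight, sub_eq_add_neg, Real.rpow_add (by linarith), Real.rpow_one]
  rw [h1]
  have := powWeight_nonneg a N
  nlinarith

theorem tendsto_weightSum_atTop {a : ℝ} (ha : 0 < a) (ha1 : a < 1) :
    Tendsto (weightSum a) atTop atTop := by
  have h1 : Tendsto (fun N : ℕ => (N : ℝ) ^ (1 - a) / 2) atTop atTop :=
    ((tendsto_rpow_atTop (by linarith)).comp tendsto_natCast_atTop_atTop).atTop_div_const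
      zero_lt_two
  refine tendsto_atTop_mono' atTop ?_ h1
  filter_upwards [eventually_ge_atTop 2] with N hN using half_rpow_le_weightSum ha hN

theorem weightSum_pos {a : ℝ} (ha : 0 < a) {N : ℕ} (hN : 2 ≤ N) : 0 < weightSum a N := by
  refine lt_of_lt_of_le ?_ (half_rpow_le_weightSum ha hN)
  have : (0 : ℝ) < N := by
    have : 0 < N := by omega
    exact_mod_cast this
  positivity

theorem weightSum_le_add {a : ℝ} (ha : 0 < a) {N M : ℕ} (hN : 1 ≤ N) (hNM : N ≤ M) :
    weightSum a M ≤ weightSum a N + ((M : ℝ) - N) * powWeight a N := by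
  induction M, hNM using Nat.le_induction with
  | base => simp
  | succ M hM ih =>
    rw [weightSum, Finset.sum_range_succ, ← weightSum]
    have := powWeight_antitone ha hN hM
    push_cast
    linarith

/-- Between consecutive powers at most `(k + 1) ^ s - k ^ s` weights of size `(k ^ s) ^ (-a)` are
added, and `k ^ s` weights of that size amount to at most `2 * weightSum a (k ^ s)`. -/
theorem tendsto_weightSum_pow_succ_div {a : ℝ} (ha : 0 < a) {s : ℕ} (hs : 1 ≤ s) :
    Tendsto (fun k : ℕ => weightSum a ((k + 1) ^ s) / weightSum a (k ^ s)) atTop (𝓝 1) := by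
  have h1 : Tendsto (fun k : ℕ => 1 + 2 * ((1 + 1 / (k : ℝ)) ^ s - 1)) atTop (𝓝 1) := by
    have h2 : Tendsto (fun k : ℕ => 1 / (k : ℝ)) atTop (𝓝 0) := tendsto_one_div_atTop_nhds_zero_nat
    have h3 := ((((h2.const_add 1).pow s).sub_const 1).const_mul 2).const_add 1
    simpa using h3
  refine tendsto_of_tendsto_of_tendsto_of_le_of_le' tendsto_const_nhds h1 ?_ ?_
  · filter_upwards [eventually_ge_atTop 2] with k hk
    have hk2 : 2 ≤ k ^ s := hk.trans (Nat.le_self_pow (by omega) k)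
    rw [one_le_div (weightSum_pos ha hk2)]
    exact weightSum_mono a (Nat.pow_le_pow_left (Nat.le_succ k) s)
  · filter_upwards [eventually_ge_atTop 2] with k hk
    have hk2 : 2 ≤ k ^ s := hk.trans (Nat.le_self_pow (by omega) k)
    have hW := weightSum_pos ha hk2
    have hk0 : (0 : ℝ) < k := by
      have : 0 < k := by omega
      exact_mod_cast this
    have hN0 : (0 : ℝ) < (k ^ s : ℕ) := by
      have : 0 < k ^ s := by omega
      exact_mod_cast this
    have hle := weightSum_le_add ha (by omega : 1 ≤ k ^ s)
      (Nat.pow_le_pow_left (Nat.le_succ k) s)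
    have hhalf := half_rpow_le_weightSum ha hk2
    have h4 : ((k ^ s : ℕ) : ℝ) ^ (1 - a) = (k ^ s : ℕ) * powWeight a (k ^ s) := by
      rw [powWeight, sub_eq_add_neg, Real.rpow_add hN0, Real.rpow_one]
    rw [h4] at hhalf
    have h5 : ((1 + 1 / (k : ℝ)) ^ s - 1) * (k ^ s : ℕ) = ((k + 1) ^ s : ℕ) - (k ^ s : ℕ) := by
      push_cast
      rw [sub_mul, ← mul_pow, one_mul]
      congr 2
      field_simp
    rw [div_le_iff₀ hW]
    refine hle.trans ?_
    rw [Nat.succ_eq_add_one, ← h5, add_mul, one_mul]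
    have h6 : 0 ≤ (1 + 1 / (k : ℝ)) ^ s - 1 :=
      sub_nonneg.2 (one_le_pow₀ (by have : 0 ≤ 1 / (k : ℝ) := by positivity
                                    linarith))
    nlinarith

/-- Abel summation of the decreasing part. The constant 2 collects the upward jump from index 0 to 1
and the boundary term at index 1. -/
theorem sum_mul_abs_powWeight_sub_le {a : ℝ} (ha : 0 < a) (M : ℕ) :
    ∑ i ∈ Finset.range M, |powWeight a (i + 1) - powWeight a i| * ((i : ℝ) + 1) ≤
      weightSum a M + 2 := by
  have key : ∀ M : ℕ, ∑ i ∈ Finset.range (M + 1),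
      |powWeight a (i + 1) - powWeight a i| * ((i : ℝ) + 1) =
      weightSum a (M + 1) + 2 - ((M : ℝ) + 1) * powWeight a (M + 1) := by
    intro M
    induction M with
    | zero =>
      simp [weightSum, powWeight_zero ha]
      have : powWeight a 1 = 1 := by simp [powWeight]
      rw [this]; norm_num
    | succ M ih =>
      rw [Finset.sum_range_succ, ih, weightSum, weightSum, Finset.sum_range_succ _ (M + 1),
        abs_of_nonpos (sub_nonpos.2 (powWeight_antitone ha (by omega) (Nat.le_succ (M + 1))))]
      push_cast
      ring
  cases M with
  | zero => simp [weightSum]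
  | succ M =>
    rw [key M]
    have := powWeight_nonneg a (M + 1)
    have hM : (0 : ℝ) ≤ M := Nat.cast_nonneg M
    nlinarith

/-- Cesàro convergence to zero implies convergence to zero of the averages with weights
`n ^ (-a)`. -/
theorem tendsto_weighted_of_cesaro {a : ℝ} (ha : 0 < a) (ha1 : a < 1) {b : ℕ → ℝ}
    (hb : Tendsto (fun N : ℕ => (∑ n ∈ Finset.range N, b n) / N) atTop (𝓝 0)) :
    Tendsto (fun N : ℕ => (∑ n ∈ Finset.range N, powWeight a n * b n) / weightSum a N)
      atTop (𝓝 0) := by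
  rw [← tendsto_add_atTop_iff_nat 1]
  set B : ℕ → ℝ := fun N => ∑ n ∈ Finset.range N, b n with hB
  have hW := (tendsto_weightSum_atTop ha ha1).comp (tendsto_add_atTop_nat 1)
  have hBo : (fun i : ℕ => B (i + 1)) =o[atTop] fun i : ℕ => (i : ℝ) + 1 := by
    rw [Asymptotics.isLittleO_iff_tendsto (fun i h => absurd h (by positivity))]
    refine ((tendsto_add_atTop_iff_nat 1).2 hb).congr fun i => ?_
    simp [hB]
  have hg0 : ∀ i : ℕ, 0 ≤ |powWeight a (i + 1) - powWeight a i| * ((i : ℝ) + 1) +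
      powWeight a (i + 1) := fun i => by
    have := powWeight_nonneg a (i + 1)
    positivity
  have hshift : ∀ M : ℕ, ∑ i ∈ Finset.range M, powWeight a (i + 1) = weightSum a (M + 1) :=
    fun M => by rw [weightSum, Finset.sum_range_succ', powWeight_zero ha, add_zero]
  -- The extra summand `powWeight a (i + 1)` makes the comparison series diverge, as summing a
  -- little-o relation requires, and costs only another `weightSum`.
  have hho : (fun i : ℕ => (powWeight a (i + 1) - powWeight a i) * B (i + 1)) =o[atTop]
      fun i : ℕ => |powWeight a (i + 1) - powWeight a i| * ((i : ℝ) + 1) + powWeight a (i + 1) := by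
    refine ((Asymptotics.isBigO_refl _ _).mul_isLittleO hBo).trans_isBigO
      (Asymptotics.IsBigO.of_bound 1 (Eventually.of_forall fun i => ?_))
    rw [one_mul, Real.norm_of_nonneg (hg0 i), norm_mul, Real.norm_eq_abs,
      Real.norm_of_nonneg (by positivity : (0 : ℝ) ≤ (i : ℝ) + 1)]
    exact le_add_of_nonneg_right (powWeight_nonneg _ _)
  have hsum := hho.sum_range hg0 (by
    refine tendsto_atTop_mono (fun M => ?_) hW
    rw [Finset.sum_add_distrib, hshift]
    exact le_add_of_nonneg_left (Finset.sum_nonneg fun i _ => by positivity))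
  have hO : (fun M : ℕ => ∑ i ∈ Finset.range M,
      (|powWeight a (i + 1) - powWeight a i| * ((i : ℝ) + 1) + powWeight a (i + 1))) =O[atTop]
      fun M : ℕ => weightSum a (M + 1) := by
    refine Asymptotics.IsBigO.of_bound 4 ?_
    filter_upwards [hW.eventually_ge_atTop 1] with M hM
    simp only [Function.comp_apply] at hM
    rw [Real.norm_of_nonneg (Finset.sum_nonneg fun i _ => hg0 i),
      Real.norm_of_nonneg (weightSum_nonneg _ _), Finset.sum_add_distrib, hshift]
    have h1 := sum_mul_abs_powWeight_sub_le ha M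
    have h2 := weightSum_mono a (Nat.le_succ M)
    simp only [Nat.succ_eq_add_one] at h2
    linarith
  have h1 := (hsum.trans_isBigO hO).tendsto_div_nhds_zero
  have hO2 : (fun M : ℕ => powWeight a M * ((M : ℝ) + 1)) =O[atTop]
      fun M : ℕ => weightSum a (M + 1) := by
    refine Asymptotics.IsBigO.of_bound 2 ?_
    filter_upwards [eventually_ge_atTop 1] with M hM
    have hM' : (1 : ℝ) ≤ M := by exact_mod_cast hM
    have h3 := sub_one_mul_powWeight_le_weightSum (N := M + 1) (M := M) ha le_rfl
    have h4 := powWeight_nonneg a M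
    rw [Real.norm_of_nonneg (by positivity), Real.norm_of_nonneg (weightSum_nonneg _ _)]
    push_cast at h3
    nlinarith
  have h2 := (((Asymptotics.isBigO_refl (fun M : ℕ => powWeight a M) atTop).mul_isLittleO
    hBo).trans_isBigO hO2).tendsto_div_nhds_zero
  have h3 := h2.sub h1
  rw [sub_zero] at h3
  refine h3.congr fun M => ?_
  have h4 := Finset.sum_range_by_parts (powWeight a) b (M + 1)
  simp only [smul_eq_mul, Nat.add_sub_cancel] at h4
  rw [← sub_div, h4]

end Weights

/-! ### Interpolation between polynomial times. -/

section Sandwich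

/-- If the ratio of two monotone sequences converges along the `s`-th powers, and the denominator
grows slowly along the `s`-th powers, then the ratio converges. -/
theorem tendsto_div_of_tendsto_div_pow {S W : ℕ → ℝ} {s : ℕ} (hs : 1 ≤ s) {L : ℝ}
    (hS : Monotone S) (hS0 : ∀ N, 0 ≤ S N) (hW : Monotone W) (hWpos : ∀ N, 2 ≤ N → 0 < W N)
    (hWs : Tendsto (fun k : ℕ => W ((k + 1) ^ s) / W (k ^ s)) atTop (𝓝 1))
    (h : Tendsto (fun k : ℕ => S (k ^ s) / W (k ^ s)) atTop (𝓝 L)) :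
    Tendsto (fun N => S N / W N) atTop (𝓝 L) := by
  -- The integer `s`-th root: `r N ^ s ≤ N < (r N + 1) ^ s`.
  set r : ℕ → ℕ := fun N => Nat.findGreatest (fun k => k ^ s ≤ N) N with hr
  have hr1 : ∀ N, r N ^ s ≤ N := fun N =>
    Nat.findGreatest_spec (P := fun k => k ^ s ≤ N) (Nat.zero_le N)
      (by rw [zero_pow (by omega)]; exact Nat.zero_le N)
  have hr2 : ∀ N, N < (r N + 1) ^ s := fun N => by
    by_contra hcon
    have h1 := Nat.le_findGreatest (P := fun k => k ^ s ≤ N)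
      ((Nat.le_self_pow (by omega) _).trans (not_lt.1 hcon)) (not_lt.1 hcon)
    have h2 : r N + 1 ≤ r N := h1
    omega
  have hrt : Tendsto r atTop atTop := by
    refine tendsto_atTop.2 fun K => ?_
    filter_upwards [eventually_ge_atTop (K ^ s)] with N hN
    exact Nat.le_findGreatest (P := fun k => k ^ s ≤ N)
      ((Nat.le_self_pow (by omega) K).trans hN) hN
  have hpos : ∀ k : ℕ, 2 ≤ k → 0 < W (k ^ s) := fun k hk =>
    hWpos _ (hk.trans (Nat.le_self_pow (by omega) k))
  have hlow : Tendsto (fun k : ℕ => S (k ^ s) / W ((k + 1) ^ s)) atTop (𝓝 L) := by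
    have h1 := h.div hWs one_ne_zero
    rw [div_one] at h1
    refine h1.congr' ?_
    filter_upwards [eventually_ge_atTop 2] with k hk
    have h2 := hpos k hk
    have h3 := hpos (k + 1) (by omega)
    simp only [Pi.div_apply]
    field_simp
  have hup : Tendsto (fun k : ℕ => S ((k + 1) ^ s) / W (k ^ s)) atTop (𝓝 L) := by
    have h1 := ((tendsto_add_atTop_iff_nat 1).2 h).mul hWs
    rw [mul_one] at h1
    refine h1.congr' ?_
    filter_upwards [eventually_ge_atTop 2] with k hk
    have h2 := hpos k hk
    have h3 := hpos (k + 1) (by omega)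
    field_simp
  refine tendsto_of_tendsto_of_tendsto_of_le_of_le' (hlow.comp hrt) (hup.comp hrt) ?_ ?_
  · filter_upwards [eventually_ge_atTop 2] with N hN
    exact div_le_div₀ (hS0 N) (hS (hr1 N)) (hWpos N hN) (hW (hr2 N).le)
  · filter_upwards [eventually_ge_atTop 2, hrt.eventually_ge_atTop 2] with N hN hrN
    exact div_le_div₀ (hS0 _) (hS (hr2 N).le) (hpos _ hrN) (hW (hr1 N))

end Sandwich

/-! ### Van der Corput's inequality. -/

section VanDerCorput

theorem sum_range_sum_add (g : ℕ → ℕ → ℝ) (N : ℕ) :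
    ∑ m ∈ Finset.range N, ∑ n ∈ Finset.range (N - m), g n (n + m) =
      ∑ j ∈ Finset.range N, ∑ i ∈ Finset.range (j + 1), g i j := by
  rw [← Finset.sum_range_diag_flip N fun m n => g n (n + m)]
  refine Finset.sum_congr rfl fun j _ => ?_
  rw [← Finset.sum_range_reflect]
  refine Finset.sum_congr rfl fun i hi => ?_
  have : i ≤ j := Nat.lt_succ_iff.1 (Finset.mem_range.1 hi)
  congr 1 <;> omega

/-- Grouping by the difference `m = j - i` sees each off-diagonal pair once and the diagonal once,
so doubling it overcounts the diagonal. -/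
theorem sum_sum_range_add_sum_diag {g : ℕ → ℕ → ℝ} (hg : ∀ i j, g i j = g j i) (N : ℕ) :
    ∑ i ∈ Finset.range N, ∑ j ∈ Finset.range N, g i j + ∑ i ∈ Finset.range N, g i i =
      2 * ∑ m ∈ Finset.range N, ∑ n ∈ Finset.range (N - m), g n (n + m) := by
  rw [sum_range_sum_add]
  induction N with
  | zero => simp
  | succ N ih =>
    simp only [Finset.sum_range_succ _ N, Finset.sum_add_distrib]
    have h3 : ∑ j ∈ Finset.range N, g N j = ∑ j ∈ Finset.range N, g j N :=
      Finset.sum_congr rfl fun j _ => hg N j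
    rw [h3]
    linarith

theorem sum_mul_mul_le_autocorrelationSum {Y c : ℕ → ℝ} (h0 : 0 ≤ c 0) (hc : ∀ m, |c m| ≤ c 0)
    (N : ℕ) {g : ℕ → ℕ → ℝ} (hg : ∀ i j, g i j = g j i)
    (hgc : ∀ n m, g n (n + m) = Y n * Y (n + m) * c m) :
    ∑ i ∈ Finset.range N, ∑ j ∈ Finset.range N, g i j ≤ 2 * (autocorrelationSum Y N * c 0) := by
  have h1 := sum_sum_range_add_sum_diag hg N
  have h2 : 0 ≤ ∑ i ∈ Finset.range N, g i i := Finset.sum_nonneg fun i _ => by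
    have := hgc i 0
    rw [add_zero] at this
    rw [this]
    exact mul_nonneg (mul_self_nonneg _) h0
  have h3 : ∑ m ∈ Finset.range N, ∑ n ∈ Finset.range (N - m), g n (n + m) ≤
      autocorrelationSum Y N * c 0 := by
    rw [autocorrelationSum, Finset.sum_mul]
    refine Finset.sum_le_sum fun m _ => ?_
    simp only [hgc, ← Finset.sum_mul]
    refine (le_abs_self _).trans ?_
    rw [abs_mul]
    exact mul_le_mul_of_nonneg_left (hc m) (abs_nonneg _)
  linarith

variable {X : Type v} [MeasurableSpace X] {μ : Measure X} {T : X → X}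

theorem MeasureTheory.MeasurePreserving.integral_comp_ae {S : X → X} (hS : MeasurePreserving S μ μ)
    {g : X → ℝ} (hg : AEStronglyMeasurable g μ) : ∫ x, g (S x) ∂μ = ∫ x, g x ∂μ := by
  rw [← integral_map hS.measurable.aemeasurable (by rwa [hS.map_eq]), hS.map_eq]

/-- Van der Corput's inequality for weighted ergodic sums. -/
theorem integral_sq_sum_iterate_le (hT : MeasurePreserving T μ μ) {f : X → ℝ}
    (hf : MemLp f 2 μ) (Y : ℕ → ℝ) (N : ℕ) :
    ∫ x, (∑ n ∈ Finset.range N, Y n * f (T^[n] x)) ^ 2 ∂μ ≤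
      2 * (autocorrelationSum Y N * ∫ x, f x ^ 2 ∂μ) := by
  have hfn : ∀ n, MemLp (fun x => f (T^[n] x)) 2 μ := fun n =>
    hf.comp_measurePreserving (hT.iterate n)
  have hint : ∀ i j, Integrable (fun x => f (T^[i] x) * f (T^[j] x)) μ := fun i j =>
    (hfn i).integrable_mul (hfn j)
  have hfsq : ∀ n, ∫ x, f (T^[n] x) ^ 2 ∂μ = ∫ x, f x ^ 2 ∂μ := fun n =>
    (hT.iterate n).integral_comp_ae (g := fun x => f x ^ 2) (hf.aestronglyMeasurable.pow 2)
  -- By invariance the correlation of `f` at times `n` and `n + m` depends only on `m`, and it is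
  -- dominated by `c 0`; invertibility of `T` is not needed.
  set c : ℕ → ℝ := fun m => ∫ x, f x * f (T^[m] x) ∂μ with hc
  have hc0 : c 0 = ∫ x, f x ^ 2 ∂μ := by simp [hc, sq]
  have hc00 : 0 ≤ c 0 := by rw [hc0]; exact integral_nonneg fun x => sq_nonneg _
  have hcm : ∀ m, |c m| ≤ c 0 := by
    intro m
    have h1 : Integrable (fun x => (f x ^ 2 + f (T^[m] x) ^ 2) / 2) μ :=
      (hf.integrable_sq.add (hfn m).integrable_sq).div_const 2
    calc |c m| ≤ ∫ x, |f x * f (T^[m] x)| ∂μ := abs_integral_le_integral_abs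
      _ ≤ ∫ x, (f x ^ 2 + f (T^[m] x) ^ 2) / 2 ∂μ :=
          integral_mono (hint 0 m).abs h1 fun x => by
            simp only [abs_mul]
            nlinarith [sq_nonneg (|f x| - |f (T^[m] x)|), sq_abs (f x), sq_abs (f (T^[m] x))]
      _ = c 0 := by
          rw [integral_div, integral_add hf.integrable_sq (hfn m).integrable_sq, hfsq, hc0]
          ring
  have hexp : ∫ x, (∑ n ∈ Finset.range N, Y n * f (T^[n] x)) ^ 2 ∂μ =
      ∑ i ∈ Finset.range N, ∑ j ∈ Finset.range N,
        Y i * Y j * ∫ x, f (T^[i] x) * f (T^[j] x) ∂μ := by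
    have h1 : ∀ x, (∑ n ∈ Finset.range N, Y n * f (T^[n] x)) ^ 2 =
        ∑ i ∈ Finset.range N, ∑ j ∈ Finset.range N,
          Y i * Y j * (f (T^[i] x) * f (T^[j] x)) := fun x => by
      rw [sq, Finset.sum_mul_sum]
      exact Finset.sum_congr rfl fun i _ => Finset.sum_congr rfl fun j _ => by ring
    simp only [h1]
    rw [integral_finsetSum _ fun i _ => integrable_finsetSum _ fun j _ => (hint i j).const_mul _]
    refine Finset.sum_congr rfl fun i _ => ?_
    rw [integral_finsetSum _ fun j _ => (hint i j).const_mul _]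
    exact Finset.sum_congr rfl fun j _ => integral_const_mul _ _
  rw [hexp, ← hc0]
  refine sum_mul_mul_le_autocorrelationSum hc00 hcm N (fun i j => ?_) fun n m => ?_
  · rw [mul_comm (Y i)]
    congr 1
    exact integral_congr_ae (Eventually.of_forall fun x => mul_comm _ _)
  · congr 1
    have h2 := (hT.iterate n).integral_comp_ae (g := fun x => f x * f (T^[m] x))
      (hint 0 m).aestronglyMeasurable
    simp only [hc]
    rw [← h2]
    simp only [← Function.iterate_add_apply, add_comm n m]

end VanDerCorput

/-! ### Ergodic averages along a fixed set with small autocorrelations. -/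

section Deterministic

/-- The real-valued indicator sequence of a set of natural numbers. -/
noncomputable def indicatorSeq (Λ : Set ℕ) (n : ℕ) : ℝ := Λ.indicator (fun _ => 1) n

theorem indicatorSeq_nonneg (Λ : Set ℕ) (n : ℕ) : 0 ≤ indicatorSeq Λ n :=
  indicator_nonneg (fun _ _ => zero_le_one) _

/-- The set `Λ` has density `n ^ (-a)` in a strong sense: the autocorrelations of its centred
indicator sequence are summable along the `s`-th powers after normalization. -/
def HasSmallAutocorrelation (Λ : Set ℕ) (a : ℝ) (s : ℕ) : Prop :=
  Summable fun k : ℕ => autocorrelationSum (fun n => indicatorSeq Λ n - powWeight a n) (k ^ s) /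
    ((k ^ s : ℕ) : ℝ) ^ (2 - 2 * a)

variable {Λ : Set ℕ} {a : ℝ} {s : ℕ}

/-- Van der Corput makes the squared `L²` norms, divided by `N ^ (2 - 2 * a)`, summable along `N = k
^ s`, so the squares tend to zero almost everywhere; `weightSum a N` is at least half of `N ^ (1 -
a)`. -/
theorem HasSmallAutocorrelation.ae_tendsto_centred {X : Type v} [MeasurableSpace X] {μ : Measure X}
    {T : X → X} (hΛ : HasSmallAutocorrelation Λ a s) (ha : 0 < a) (hs : 1 ≤ s)
    (hT : MeasurePreserving T μ μ) {f : X → ℝ} (hf : MemLp f 2 μ) :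
    ∀ᵐ x ∂μ, Tendsto (fun k : ℕ => (∑ n ∈ Finset.range (k ^ s),
      (indicatorSeq Λ n - powWeight a n) * f (T^[n] x)) / weightSum a (k ^ s)) atTop (𝓝 0) := by
  set Y : ℕ → ℝ := fun n => indicatorSeq Λ n - powWeight a n with hY
  set S : ℕ → X → ℝ := fun N x => ∑ n ∈ Finset.range N, Y n * f (T^[n] x) with hS
  have hSm : ∀ N, MemLp (S N) 2 μ := fun N =>
    memLp_finsetSum _ fun n _ => (hf.comp_measurePreserving (hT.iterate n)).const_mul (Y n)
  have hden : ∀ k : ℕ, 0 ≤ ((k ^ s : ℕ) : ℝ) ^ (2 - 2 * a) := fun k =>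
    Real.rpow_nonneg (Nat.cast_nonneg _) _
  have hsum : Summable fun k : ℕ => ∫ x, S (k ^ s) x ^ 2 / ((k ^ s : ℕ) : ℝ) ^ (2 - 2 * a) ∂μ := by
    refine Summable.of_nonneg_of_le
      (fun k => integral_nonneg fun x => div_nonneg (sq_nonneg _) (hden k)) (fun k => ?_)
      (Summable.mul_right (2 * ∫ x, f x ^ 2 ∂μ) hΛ)
    rw [integral_div]
    calc _ ≤ 2 * (autocorrelationSum Y (k ^ s) * ∫ x, f x ^ 2 ∂μ) /
          ((k ^ s : ℕ) : ℝ) ^ (2 - 2 * a) :=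
          div_le_div_of_nonneg_right (integral_sq_sum_iterate_le hT hf Y (k ^ s)) (hden k)
      _ = _ := by ring
  have hae := ae_summable_of_summable_integral (ν := μ)
    (fun k x => div_nonneg (sq_nonneg (S (k ^ s) x)) (hden k))
    (fun k => (hSm (k ^ s)).integrable_sq.div_const _) hsum
  filter_upwards [hae] with x hx
  have h1 : Tendsto (fun k : ℕ => 2 * √(S (k ^ s) x ^ 2 / ((k ^ s : ℕ) : ℝ) ^ (2 - 2 * a)))
      atTop (𝓝 0) := by
    have := (hx.tendsto_atTop_zero.sqrt).const_mul 2
    simpa using this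
  refine squeeze_zero_norm' ?_ h1
  filter_upwards [eventually_ge_atTop 2] with k hk
  have hk2 : 2 ≤ k ^ s := hk.trans (Nat.le_self_pow (by omega) k)
  have hW := weightSum_pos ha hk2
  have hhalf := half_rpow_le_weightSum ha hk2
  have hN0 : (0 : ℝ) < (k ^ s : ℕ) := by
    have : 0 < k ^ s := by omega
    exact_mod_cast this
  have h2 : ((k ^ s : ℕ) : ℝ) ^ (2 - 2 * a) = (((k ^ s : ℕ) : ℝ) ^ (1 - a)) ^ 2 := by
    rw [← Real.rpow_natCast, ← Real.rpow_mul hN0.le]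
    congr 1
    push_cast
    ring
  have hP : 0 < ((k ^ s : ℕ) : ℝ) ^ (1 - a) := Real.rpow_pos_of_pos hN0 _
  rw [h2, ← div_pow, Real.sqrt_sq_eq_abs, abs_div, abs_of_pos hP, norm_div, Real.norm_eq_abs,
    Real.norm_of_nonneg hW.le, div_le_iff₀ hW]
  calc |S (k ^ s) x| = 2 * (|S (k ^ s) x| / ((k ^ s : ℕ) : ℝ) ^ (1 - a)) *
        (((k ^ s : ℕ) : ℝ) ^ (1 - a) / 2) := by field_simp
    _ ≤ _ := by gcongr

theorem HasSmallAutocorrelation.ae_tendsto_pow {X : Type v} [MeasurableSpace X] {μ : Measure X}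
    [IsProbabilityMeasure μ] {T : X → X} (hΛ : HasSmallAutocorrelation Λ a s) (ha : 0 < a)
    (ha1 : a < 1) (hs : 1 ≤ s) (hT : MeasurePreserving T μ μ) {f : X → ℝ} (hf : MemLp f 2 μ) :
    ∀ᵐ x ∂μ, Tendsto (fun k : ℕ => (∑ n ∈ Finset.range (k ^ s),
      indicatorSeq Λ n * f (T^[n] x)) / weightSum a (k ^ s)) atTop
      (𝓝 ((μ[f | almostInvariants μ T]) x)) := by
  filter_upwards [hΛ.ae_tendsto_centred ha hs hT hf,
    ae_tendsto_birkhoffSum_sub_condExp hT (hf.integrable one_le_two)] with x h1 h2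
  set E := (μ[f | almostInvariants μ T]) x with hE
  have hpow : Tendsto (fun k : ℕ => k ^ s) atTop atTop := tendsto_pow_atTop (by omega)
  have h3 := (tendsto_weighted_of_cesaro ha ha1 h2).comp hpow
  have h4 := (h1.add h3).add_const E
  rw [add_zero, zero_add] at h4
  refine h4.congr' ?_
  filter_upwards [eventually_ge_atTop 2] with k hk
  have hW := weightSum_pos ha (hk.trans (Nat.le_self_pow (by omega : s ≠ 0) k))
  simp only [Function.comp_apply, sub_mul, mul_sub, Finset.sum_sub_distrib, ← Finset.sum_mul]
  rw [← weightSum]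
  field_simp
  ring

theorem monotone_sum_range {g : ℕ → ℝ} (hg : ∀ n, 0 ≤ g n) :
    Monotone fun N => ∑ n ∈ Finset.range N, g n := fun _ _ h =>
  Finset.sum_le_sum_of_subset_of_nonneg (Finset.range_mono h) fun _ _ _ => hg _

theorem HasSmallAutocorrelation.ae_tendsto_of_nonneg {X : Type v} [MeasurableSpace X]
    {μ : Measure X} [IsProbabilityMeasure μ] {T : X → X} (hΛ : HasSmallAutocorrelation Λ a s)
    (ha : 0 < a) (ha1 : a < 1) (hs : 1 ≤ s) (hT : MeasurePreserving T μ μ) {f : X → ℝ}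
    (hf : MemLp f 2 μ) (hf0 : ∀ x, 0 ≤ f x) :
    ∀ᵐ x ∂μ, Tendsto (fun N : ℕ => (∑ n ∈ Finset.range N,
      indicatorSeq Λ n * f (T^[n] x)) / weightSum a N) atTop
      (𝓝 ((μ[f | almostInvariants μ T]) x)) := by
  filter_upwards [hΛ.ae_tendsto_pow ha ha1 hs hT hf] with x hx
  have h0 : ∀ n, 0 ≤ indicatorSeq Λ n * f (T^[n] x) := fun n =>
    mul_nonneg (indicatorSeq_nonneg Λ n) (hf0 _)
  exact tendsto_div_of_tendsto_div_pow hs (monotone_sum_range h0)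
    (fun N => Finset.sum_nonneg fun n _ => h0 n) (weightSum_mono a)
    (fun N hN => weightSum_pos ha hN) (tendsto_weightSum_pow_succ_div ha hs) hx

/-- This is the pointwise theorem for `f = 1` on the one-point system, where almost everywhere means
everywhere. -/
theorem HasSmallAutocorrelation.tendsto_count (hΛ : HasSmallAutocorrelation Λ a s)
    (ha : 0 < a) (ha1 : a < 1) (hs : 1 ≤ s) :
    Tendsto (fun N : ℕ => (∑ n ∈ Finset.range N, indicatorSeq Λ n) / weightSum a N)
      atTop (𝓝 1) := by
  have h := hΛ.ae_tendsto_of_nonneg ha ha1 hs (MeasurePreserving.id (Measure.dirac ()))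
    (f := fun _ => 1) (memLp_const 1) (fun _ => zero_le_one)
  rw [ae_dirac_eq] at h
  have h1 : Tendsto _ _ _ := h
  simpa [condExp_const (almostInvariants_le _ _)] using h1

theorem HasSmallAutocorrelation.infinite (hΛ : HasSmallAutocorrelation Λ a s)
    (ha : 0 < a) (ha1 : a < 1) (hs : 1 ≤ s) : Λ.Infinite := by
  classical
  intro hfin
  have h1 : Tendsto (fun N : ℕ => (hfin.toFinset.card : ℝ) / weightSum a N) atTop (𝓝 0) :=
    (tendsto_weightSum_atTop ha ha1).const_div_atTop _
  have h2 := le_of_tendsto_of_tendsto (hΛ.tendsto_count ha ha1 hs) h1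
    (Eventually.of_forall fun N => by
      refine div_le_div_of_nonneg_right ?_ (weightSum_nonneg a N)
      have h3 : ∀ n, indicatorSeq Λ n = if n ∈ hfin.toFinset then 1 else 0 := fun n => by
        simp [indicatorSeq, indicator]
      simp only [h3]
      rw [Finset.sum_ite_mem, Finset.sum_const, nsmul_one]
      exact_mod_cast Finset.card_le_card Finset.inter_subset_right)
  linarith

/-- As the enumeration starts at 0, exactly its first `N` terms lie strictly below the term of index
`N`. -/
theorem sum_increasingEnum (hΛ : Λ.Infinite) (g : ℕ → ℝ) (N : ℕ) :
    ∑ n ∈ Finset.range N, g (increasingEnum Λ n) =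
      ∑ n ∈ Finset.range (increasingEnum Λ N), indicatorSeq Λ n * g n := by
  classical
  have hinf : (Set.ofPred fun n => n ∈ Λ).Infinite := hΛ
  have h1 : ∀ M, ∑ n ∈ Finset.range M, indicatorSeq Λ n * g n =
      ∑ n ∈ Finset.range M with n ∈ Λ, g n := fun M => by
    rw [Finset.sum_filter]
    refine Finset.sum_congr rfl fun n _ => ?_
    by_cases h : n ∈ Λ <;> simp [indicatorSeq, h]
  simp only [h1, increasingEnum]
  induction N with
  | zero =>
    have h2 := Nat.count_nth_of_infinite hinf 0
    rw [Nat.count_eq_card_filter_range, Finset.card_eq_zero] at h2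
    rw [h2]
    simp
  | succ N ih =>
    rw [Nat.filter_range_nth_eq_insert_of_infinite hinf, Finset.sum_insert (by simp),
      Finset.sum_range_succ, ih, add_comm]

theorem HasSmallAutocorrelation.ae_tendsto_ergodicAverage_of_nonneg {X : Type v}
    [MeasurableSpace X] {μ : Measure X} [IsProbabilityMeasure μ] {T : X → X}
    (hΛ : HasSmallAutocorrelation Λ a s) (ha : 0 < a) (ha1 : a < 1) (hs : 1 ≤ s)
    (hT : MeasurePreserving T μ μ) {f : X → ℝ} (hf : MemLp f 2 μ) (hf0 : ∀ x, 0 ≤ f x) :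
    ∀ᵐ x ∂μ, Tendsto (fun N : ℕ => ergodicAverage (increasingEnum Λ) T f N x) atTop
      (𝓝 ((μ[f | almostInvariants μ T]) x)) := by
  have hinf := hΛ.infinite ha ha1 hs
  have hcount := hΛ.tendsto_count ha ha1 hs
  have hnth : Tendsto (increasingEnum Λ) atTop atTop :=
    (Nat.nth_strictMono (p := fun n => n ∈ Λ) hinf).tendsto_atTop
  filter_upwards [hΛ.ae_tendsto_of_nonneg ha ha1 hs hT hf hf0] with x hx
  -- In the quotient of the two weighted limits the normalization `weightSum` cancels; evaluating at
  -- the elements of `Λ` gives the average along the enumeration.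
  have h1 := (hx.div hcount one_ne_zero).comp hnth
  rw [div_one] at h1
  refine h1.congr' ?_
  filter_upwards [hnth.eventually_ge_atTop 2] with N hN
  have hW := weightSum_pos ha hN
  have hc := sum_increasingEnum hinf (fun _ => 1) N
  simp only [Finset.sum_const, Finset.card_range, nsmul_eq_mul, mul_one] at hc
  simp only [Function.comp_apply, Pi.div_apply, ergodicAverage]
  rw [div_div_div_cancel_right₀ hW.ne', ← hc,
    ← sum_increasingEnum hinf (fun n => f (T^[n] x)) N, div_eq_inv_mul]

theorem HasSmallAutocorrelation.ae_tendsto_ergodicAverage_real {X : Type v}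
    [MeasurableSpace X] {μ : Measure X} [IsProbabilityMeasure μ] {T : X → X}
    (hΛ : HasSmallAutocorrelation Λ a s) (ha : 0 < a) (ha1 : a < 1) (hs : 1 ≤ s)
    (hT : MeasurePreserving T μ μ) {f : X → ℝ} (hf : MemLp f 2 μ) :
    ∀ᵐ x ∂μ, Tendsto (fun N : ℕ => ergodicAverage (increasingEnum Λ) T f N x) atTop
      (𝓝 ((μ[f | almostInvariants μ T]) x)) := by
  have hp : MemLp (fun x => max (f x) 0) 2 μ := hf.pos_part
  have hn : MemLp (fun x => max (-f x) 0) 2 μ := hf.neg_part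
  have hsub : f = (fun x => max (f x) 0) - fun x => max (-f x) 0 := by
    funext x
    rcases le_total (f x) 0 with h | h
    · simp [h]
    · simp [h]
  have hE := condExp_sub (hp.integrable one_le_two) (hn.integrable one_le_two)
    (almostInvariants μ T)
  rw [← hsub] at hE
  filter_upwards [hΛ.ae_tendsto_ergodicAverage_of_nonneg ha ha1 hs hT hp fun x => le_max_right _ _,
    hΛ.ae_tendsto_ergodicAverage_of_nonneg ha ha1 hs hT hn fun x => le_max_right _ _, hE]
    with x h1 h2 h3
  rw [h3]
  refine (h1.sub h2).congr fun N => ?_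
  simp only [ergodicAverage, ← mul_sub, ← Finset.sum_sub_distrib]
  congr 1
  refine Finset.sum_congr rfl fun n _ => ?_
  exact (congrFun hsub _).symm

variable {𝕜 : Type w} [RCLike 𝕜]

theorem HasSmallAutocorrelation.ae_tendsto_ergodicAverage {X : Type v}
    [MeasurableSpace X] {μ : Measure X} [IsProbabilityMeasure μ] {T : X → X}
    (hΛ : HasSmallAutocorrelation Λ a s) (ha : 0 < a) (ha1 : a < 1) (hs : 1 ≤ s)
    (hT : MeasurePreserving T μ μ) {f : X → 𝕜} (hf : MemLp f 2 μ) :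
    ∀ᵐ x ∂μ, Tendsto (fun N : ℕ => ergodicAverage (increasingEnum Λ) T f N x) atTop
      (𝓝 ((μ[f | almostInvariants μ T]) x)) := by
  have hre := ContinuousLinearMap.comp_condExp_comm (m := almostInvariants μ T)
    (hf.integrable one_le_two) (RCLike.reCLM (K := 𝕜))
  have him := ContinuousLinearMap.comp_condExp_comm (m := almostInvariants μ T)
    (hf.integrable one_le_two) (RCLike.imCLM (K := 𝕜))
  filter_upwards [hΛ.ae_tendsto_ergodicAverage_real ha ha1 hs hT hf.re,
    hΛ.ae_tendsto_ergodicAverage_real ha ha1 hs hT hf.im, hre, him] with x h1 h2 h3 h4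
  have h3' : RCLike.re ((μ[f | almostInvariants μ T]) x) =
      (μ[fun x => RCLike.re (f x) | almostInvariants μ T]) x := h3
  have h4' : RCLike.im ((μ[f | almostInvariants μ T]) x) =
      (μ[fun x => RCLike.im (f x) | almostInvariants μ T]) x := h4
  rw [← h3'] at h1
  rw [← h4'] at h2
  have h5 := (((RCLike.continuous_ofReal (K := 𝕜)).tendsto _).comp h1).add
    ((((RCLike.continuous_ofReal (K := 𝕜)).tendsto _).comp h2).mul_const RCLike.I)
  rw [RCLike.re_add_im] at h5
  refine h5.congr fun N => ?_
  simp only [Function.comp_apply, ergodicAverage, RCLike.ofReal_mul, RCLike.ofReal_inv,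
    RCLike.ofReal_natCast, RCLike.ofReal_sum, mul_assoc, ← mul_add, Finset.sum_mul,
    ← Finset.sum_add_distrib, RCLike.re_add_im]

theorem aestronglyMeasurable_ergodicAverage {X : Type v} [MeasurableSpace X] {μ : Measure X}
    {T : X → X} (hT : MeasurePreserving T μ μ) {f : X → 𝕜} (hf : AEStronglyMeasurable f μ)
    (b : ℕ → ℕ) (N : ℕ) : AEStronglyMeasurable (ergodicAverage b T f N) μ :=
  (Finset.aestronglyMeasurable_fun_sum _ fun n _ =>
    hf.comp_measurePreserving (hT.iterate (b n))).const_mul _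

theorem eLpNorm_ergodicAverage_le {X : Type v} [MeasurableSpace X] {μ : Measure X}
    {T : X → X} (hT : MeasurePreserving T μ μ) {f : X → 𝕜} (hf : AEStronglyMeasurable f μ)
    {p : ℝ≥0∞} (hp : 1 ≤ p) (b : ℕ → ℕ) (N : ℕ) :
    eLpNorm (ergodicAverage b T f N) p μ ≤ eLpNorm f p μ := by
  rcases Nat.eq_zero_or_pos N with rfl | hN
  · have : ergodicAverage b T f 0 = 0 := by funext x; simp [ergodicAverage]
    rw [this, eLpNorm_zero]
    exact zero_le
  · have h1 : ergodicAverage b T f N =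
        (N : 𝕜)⁻¹ • ∑ n ∈ Finset.range N, f ∘ T^[b n] := by
      funext x; simp [ergodicAverage]
    have h2 : eLpNorm (∑ n ∈ Finset.range N, f ∘ T^[b n]) p μ ≤ N * eLpNorm f p μ := by
      refine (eLpNorm_sum_le (fun n _ => hf.comp_measurePreserving (hT.iterate (b n))) hp).trans ?_
      rw [Finset.sum_congr rfl fun n _ =>
        eLpNorm_comp_measurePreserving hf (hT.iterate (b n))]
      simp
    have hN0 : (N : ℝ≥0∞) ≠ 0 := by simpa using hN.ne'
    have h3 : ‖(N : 𝕜)⁻¹‖ₑ = (N : ℝ≥0∞)⁻¹ := by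
      rw [enorm_inv (by simpa using hN.ne')]
      congr 1
      rw [← ofReal_norm, RCLike.norm_natCast, ENNReal.ofReal_natCast]
    rw [h1, eLpNorm_const_smul, h3]
    calc (N : ℝ≥0∞)⁻¹ * _ ≤ (N : ℝ≥0∞)⁻¹ * (N * eLpNorm f p μ) := by gcongr
      _ = eLpNorm f p μ := by
        rw [← mul_assoc, ENNReal.inv_mul_cancel hN0 (ENNReal.natCast_ne_top N), one_mul]

theorem norm_ergodicAverage_le {X : Type v} {T : X → X} {f : X → 𝕜} {c : ℝ} (hc : 0 ≤ c)
    (hf : ∀ x, ‖f x‖ ≤ c) (b : ℕ → ℕ) (N : ℕ) (x : X) : ‖ergodicAverage b T f N x‖ ≤ c := by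
  rcases Nat.eq_zero_or_pos N with rfl | hN
  · simpa [ergodicAverage] using hc
  · have hN' : (0 : ℝ) < N := by exact_mod_cast hN
    rw [ergodicAverage, norm_mul, norm_inv, RCLike.norm_natCast, inv_mul_le_iff₀ hN']
    refine (norm_sum_le _ _).trans ((Finset.sum_le_sum fun n _ => hf _).trans ?_)
    simp

/-- For averages along a sequence of times, almost everywhere convergence to the conditional
expectation for all functions in `L²` implies convergence in `L²`. -/
theorem tendsto_eLpNorm_ergodicAverage_sub {X : Type v} {m : MeasurableSpace X}
    [MeasurableSpace X] {μ : Measure X}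
    [IsProbabilityMeasure μ] {T : X → X} (hT : MeasurePreserving T μ μ) {b : ℕ → ℕ}
    (h : ∀ f : X → 𝕜, MemLp f 2 μ → ∀ᵐ x ∂μ,
      Tendsto (fun N : ℕ => ergodicAverage b T f N x) atTop (𝓝 ((μ[f | m]) x)))
    {f : X → 𝕜} (hf : MemLp f 2 μ) :
    Tendsto (fun N : ℕ => eLpNorm (ergodicAverage b T f N - μ[f | m]) 2 μ) atTop (𝓝 0) := by
  rw [ENNReal.tendsto_nhds_zero]
  intro ε hε
  have hε3 : ε / 3 ≠ 0 := (ENNReal.div_pos hε.ne' (by norm_num)).ne'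
  -- The averages of a simple function are uniformly bounded, hence uniformly integrable, so
  -- Vitali's theorem applies to `g`. The error `f - g` is handled by the `L²` contractivity of
  -- averages and conditional expectation.
  obtain ⟨g, hg, hgm⟩ := hf.exists_simpleFunc_eLpNorm_sub_lt ENNReal.ofNat_ne_top hε3
  obtain ⟨c, hc⟩ := g.exists_forall_norm_le
  have hc0 : 0 ≤ max c 0 := le_max_right _ _
  have hgc : ∀ x, ‖g x‖ ≤ max c 0 := fun x => (hc x).trans (le_max_left _ _)
  have hmeas := fun N => aestronglyMeasurable_ergodicAverage hT hgm.aestronglyMeasurable b N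
  have hui : UnifIntegrable (fun N => ergodicAverage b T g N) 2 μ := by
    refine unifIntegrable_of one_le_two ENNReal.ofNat_ne_top hmeas fun η _ => ?_
    refine ⟨(max c 0).toNNReal + 1, fun N => ?_⟩
    have hempty : {x | (max c 0).toNNReal + 1 ≤ ‖ergodicAverage b T g N x‖₊} = ∅ := by
      refine eq_empty_of_forall_notMem fun x hx => ?_
      have h1 : ((max c 0).toNNReal : ℝ) + 1 ≤ ‖ergodicAverage b T g N x‖ := by
        exact_mod_cast (show (max c 0).toNNReal + 1 ≤ ‖ergodicAverage b T g N x‖₊ from hx)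
      rw [Real.coe_toNNReal _ hc0] at h1
      linarith [norm_ergodicAverage_le (T := T) hc0 hgc b N x]
    rw [hempty, indicator_empty]
    simp
  have hlim := tendsto_Lp_finite_of_tendsto_ae one_le_two ENNReal.ofNat_ne_top hmeas
    (hgm.condExp one_le_two (m := m)) hui (h g hgm)
  filter_upwards [(ENNReal.tendsto_nhds_zero.1 hlim) (ε / 3) (pos_iff_ne_zero.2 hε3)] with N hN
  have hfg : MemLp (f - ⇑g) 2 μ := hf.sub hgm
  have hE : μ[f | m] - μ[g | m] =ᵐ[μ] μ[f - ⇑g | m] :=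
    (condExp_sub (hf.integrable one_le_two) (hgm.integrable one_le_two) m).symm
  have hdec : ergodicAverage b T f N - μ[f | m] = (ergodicAverage b T (f - ⇑g) N +
      (ergodicAverage b T g N - μ[g | m])) - (μ[f | m] - μ[g | m]) := by
    funext x
    simp only [Pi.sub_apply, Pi.add_apply, ergodicAverage, Finset.sum_sub_distrib]
    ring
  have hm1 := aestronglyMeasurable_ergodicAverage hT hfg.aestronglyMeasurable b N
  have hm2 : AEStronglyMeasurable (ergodicAverage b T g N - μ[g | m]) μ :=
    (hmeas N).sub integrable_condExp.aestronglyMeasurable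
  have hm3 : AEStronglyMeasurable (μ[f | m] - μ[g | m]) μ :=
    integrable_condExp.aestronglyMeasurable.sub integrable_condExp.aestronglyMeasurable
  rw [hdec]
  calc _ ≤ _ := eLpNorm_sub_le (hm1.add hm2) hm3 one_le_two
    _ ≤ _ := add_le_add (eLpNorm_add_le hm1 hm2 one_le_two) le_rfl
    _ ≤ (ε / 3 + ε / 3) + ε / 3 := by
        refine add_le_add (add_le_add ?_ hN) ?_
        · exact (eLpNorm_ergodicAverage_le hT hfg.aestronglyMeasurable one_le_two b N).trans hg.le
        · rw [eLpNorm_congr_ae hE]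
          exact (eLpNorm_condExp_le_eLpNorm _ one_le_two).trans hg.le
    _ = ε := ENNReal.add_thirds ε

end Deterministic

/-! ### Conclusion. -/

theorem theoremB (𝕜 : Type w) [RCLike 𝕜] (a δ : ℝ) (ha : 0 < a) (hδ : 0 ≤ δ)
    (haδ : 2 * a + δ < 1) (u : ℕ → ℝ) (hu : IsSublacunary δ u) (I : ℕ → Set ℝ) (ℓ : ℕ)
    (hI_subset : ∀ n : ℕ, 1 ≤ n → I n ⊆ Icc (0 : ℝ) 1)
    (hI_intervals : ∀ n : ℕ, 1 ≤ n → IsUnionOfIntervals ℓ (I n))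
    (hI_measure : ∀ n : ℕ, 1 ≤ n → volume (I n) = ENNReal.ofReal ((n : ℝ) ^ (-a))) :
    ∀ᵐ y ∂(volume.restrict (Icc (0 : ℝ) 1)),
      (hittingSet u I y).Infinite ∧
      IsPointwiseUniversallyGood.{v, w} 𝕜 2 (increasingEnum (hittingSet u I y)) ∧
      IsErgodicSequence.{v, w} 𝕜 (increasingEnum (hittingSet u I y)) ∧
      ∀ (X : Type v) [MeasurableSpace X] (μ : Measure X) [IsProbabilityMeasure μ] (T : X → X),
        MeasurePreserving T μ μ → ∀ f : X → 𝕜, MemLp f 2 μ →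
          ∀ᵐ x ∂μ, Tendsto
            (fun N : ℕ => ergodicAverage (increasingEnum (hittingSet u I y)) T f N x) atTop
            (𝓝 ((μ[f | almostInvariants μ T]) x)) := by
  -- The gap exponent must exceed `δ` for decorrelation and stay below `1 - 2 * a` for the moment
  -- bound to save a power.
  obtain ⟨κ, hκ1, hκ2⟩ := exists_between (show δ < 1 - 2 * a by linarith)
  obtain ⟨C, K, hC, hK, N₀, hX⟩ :=
    isNearlyUncorrelated_hitSequence ha hδ hκ1 hu hI_subset hI_intervals hI_measure
  have : IsProbabilityMeasure (volume.restrict (Ioc (0 : ℝ) 1)) := ⟨by simp⟩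
  obtain ⟨s, hs, hae⟩ := hX.exists_ae_summable ha (hδ.trans hκ1.le) (by linarith) hC hK
  rw [← restrict_Ioc_eq_restrict_Icc]
  filter_upwards [hae] with y hy
  have hΛ : HasSmallAutocorrelation (hittingSet u I y) a s := by
    simpa only [HasSmallAutocorrelation, indicatorSeq, hitSequence_eq_indicator] using hy
  have ha1 : a < 1 := by linarith
  refine ⟨hΛ.infinite ha ha1 hs, ?_, ?_, ?_⟩
  · intro X _ μ _ T hT f hf
    filter_upwards [hΛ.ae_tendsto_ergodicAverage ha ha1 hs hT hf] with x hx using ⟨_, hx⟩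
  · intro X _ μ _ T hT f hf
    exact tendsto_eLpNorm_ergodicAverage_sub hT
      (fun g hg => hΛ.ae_tendsto_ergodicAverage ha ha1 hs hT hg) hf
  · intro X _ μ _ T hT f hf
    exact hΛ.ae_tendsto_ergodicAverage ha ha1 hs hT hf
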